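/- Let $(R,\mathfrak m)$ be a regular local ring of dimension $d\ge 2$ with fraction field $K$, and let $v:K^\times\to\mathbb R$ be a real valuation whose valuation ring $V$ birationally dominates $R$ (that is, $R\subseteq V\subseteq K$ and $\mathfrak m_V\cap R=\mathfrak m$) and is zero-dimensional over $R$ (that is, $V/\mathfrak m_V$ is algebraic over $R/\mathfrak m$). Let $R=R_0\subseteq R_1\subseteq R_2\subseteq\cdots\subseteq V$ be the sequence of local quadratic transforms of $R$ along $V$: if $\mathfrak m_n$ is the maximal ideal of $R_n$ and $a_n\in\mathfrak m_n$ satisfies $a_nV=\mathfrak m_nV$, then $R_{n+1}$ is the localization of $R_n[\mathfrak m_n/a_n]$ at the prime ideal $\mathfrak m_V\cap R_n[\mathfrak m_n/a_n]$. Put $v(\mathfrak m_n)=\min\{v(x): x\in\mathfrak m_n\}$ (with $v(0)=\infty$) and $s=\sum_{n\ge 0}v(\mathfrak m_n)\in(0,\infty]$. The sequence is said to switch strongly infinitely often if there do not exist an integer $j\ge 0$ and a height one prime ideal $\mathfrak p$ of $R_j$ with $\bigcup_{n\ge 0}R_n\subseteq (R_j)_{\mathfrak p}$. The rational rank of $V$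 is $\dim_{\mathbb Q}(\Gamma_v\otimes_{\mathbb Z}\mathbb Q)$, where $\Gamma_v=v(K^\times)$ is the value group. Then: 1. If $V$ is a DVR, then $s=\infty$ and $\bigcup_{n\ge 0}R_n=V$. 2. If $s=\infty$, then the sequence $\{R_n\}_{n\ge 0}$ switches strongly infinitely often. 3. If $V$ has rational rank at least $2$, then $s<\infty$. Thus if $s=\infty$, then $V$ has rational rank $1$. 4. If $V$ has rational rank $1$ and $V$ is not a DVR, then both $s=\infty$ and $s<\infty$ are possible: there exist $R$ and $v$ as above such that $V$ has rational rank $1$, is not a DVR and $s=\infty$, and there exist $R$ and $v$ as above such that $V$ has rational rank $1$, is not a DVR and $s<\infty$. -/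

import Mathlib

open IsLocalRing
open scoped ENNReal TensorProduct

noncomputable section

namespace QuadraticTransforms

variable {K : Type*} [Field K]

/-- The ring `R[𝔪/a]` inside `K`, for a local subring `(R, 𝔪)` of the field `K` and `a ∈ K`:
the subring of `K` generated by `R` and the quotients `b / a` with `b ∈ 𝔪`. -/
def blowupChart (R : LocalSubring K) (a : K) : Subring K :=
  Subring.closure
    ((R.toSubring : Set K) ∪ Set.range fun b : maximalIdeal R.toSubring => ((b : R.toSubring) : K) / a)

/-- The center `𝔪_V ∩ A` on a subring `A` of the valuation ring `V`. -/
def center (A : Subring K) (V : ValuationSubring K) (h : A ≤ V.toLocalSubring.toSubring) : Ideal A :=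
  (maximalIdeal V.toLocalSubring.toSubring).comap (Subring.inclusion h)

instance (A : Subring K) (V : ValuationSubring K) (h : A ≤ V.toLocalSubring.toSubring) :
    (center A V h).IsPrime :=
  inferInstanceAs ((maximalIdeal V.toLocalSubring.toSubring).comap (Subring.inclusion h)).IsPrime

/-- `R'` is the local quadratic transform of the local subring `(R, 𝔪)` along `V`: for a nonzero
`a ∈ 𝔪` with `aV = 𝔪V` (for `a ∈ 𝔪` this says that `R[𝔪/a] ⊆ V`), `R'` is the localization of
`R[𝔪/a]` at the center of `V`. -/
def IsQuadraticTransformAlong (V : ValuationSubring K) (R R' : LocalSubring K) : Prop :=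
  ∃ a : maximalIdeal R.toSubring, ((a : R.toSubring) : K) ≠ 0 ∧
    ∃ h : blowupChart R ((a : R.toSubring) : K) ≤ V.toLocalSubring.toSubring,
      R' = LocalSubring.ofPrime (blowupChart R ((a : R.toSubring) : K)) (center _ V h)

/-- `V` dominates `R` and has dimension zero over `R`: the residue field of `V` is algebraic over
the residue field of `R`. -/
def IsZeroDimensionalOver (V : ValuationSubring K) (R : LocalSubring K) : Prop :=
  ∃ (h : R.toSubring ≤ V.toLocalSubring.toSubring) (_ : IsLocalHom (Subring.inclusion h)),
    letI := (ResidueField.map (Subring.inclusion h)).toAlgebra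
    Algebra.IsAlgebraic (ResidueField R.toSubring) (ResidueField V.toLocalSubring.toSubring)

/-- The valuation ring of a valuation `v : K → ℝ ∪ {∞}` (written additively). -/
def valuationRing (v : AddValuation K (WithTop ℝ)) : ValuationSubring K where
  carrier := {x | 0 ≤ v x}
  mul_mem' {x y} hx hy := by
    simp only [Set.mem_ofPred_eq, AddValuation.map_mul] at *
    exact add_nonneg hx hy
  one_mem' := by simp
  add_mem' {x y} hx hy := AddValuation.map_le_add v hx hy
  zero_mem' := by simp
  neg_mem' {x} hx := by simpa using hx
  mem_or_inv_mem' x := by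
    by_cases hx : x = 0
    · left; simp [hx]
    · have h : v x + v x⁻¹ = 0 := by
        rw [← AddValuation.map_mul, mul_inv_cancel₀ hx, AddValuation.map_one]
      by_contra! hc
      simp only [Set.mem_ofPred_eq, not_le] at hc
      obtain ⟨h1, h2⟩ := hc
      lift v x to ℝ using h1.ne_top with r
      lift v x⁻¹ to ℝ using h2.ne_top with s
      norm_cast at h h1 h2
      linarith

/-- The value group `Γ_v = v(K \ {0}) ⊆ ℝ`. -/
def valueGroup (v : AddValuation K (WithTop ℝ)) : AddSubgroup ℝ where
  carrier := {γ | ∃ x : K, v x = (γ : WithTop ℝ)}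
  zero_mem' := ⟨1, by simp⟩
  add_mem' := by
    rintro γ δ ⟨x, hx⟩ ⟨y, hy⟩
    exact ⟨x * y, by simp [hx, hy]⟩
  neg_mem' := by
    rintro γ ⟨x, hx⟩
    have hx0 : x ≠ 0 := by
      rintro rfl
      simp at hx
    have h : v x + v x⁻¹ = 0 := by
      rw [← AddValuation.map_mul, mul_inv_cancel₀ hx0, AddValuation.map_one]
    refine ⟨x⁻¹, ?_⟩
    rw [hx] at h
    cases hy : v x⁻¹ with
    | top => simp [hy] at h
    | coe δ =>
      rw [hy] at h
      norm_cast at h ⊢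
      linarith

/-- The rational rank `dim_ℚ (Γ_v ⊗_ℤ ℚ)`. -/
def rationalRank (v : AddValuation K (WithTop ℝ)) : Cardinal :=
  Module.rank ℚ (ℚ ⊗[ℤ] valueGroup v)

/-- The map `ℝ ∪ {∞} → [0, ∞]` which is the identity on nonnegative values. -/
def toENNReal : WithTop ℝ → ℝ≥0∞
  | ⊤ => ⊤
  | (r : ℝ) => ENNReal.ofReal r

/-- `v(𝔪)`, the least value of `v` on the maximal ideal `𝔪` of `R`; it is only used for local rings
`R` dominated by the valuation ring of `v`, where the values on `𝔪` are positive. -/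
def maximalIdealValue (v : AddValuation K (WithTop ℝ)) (R : LocalSubring K) : ℝ≥0∞ :=
  ⨅ x : maximalIdeal R.toSubring, toENNReal (v ((x : R.toSubring) : K))

/-- The sum `s = ∑ v(𝔪ₙ)`, in `[0, ∞]`. -/
def valueSum (v : AddValuation K (WithTop ℝ)) (R : ℕ → LocalSubring K) : ℝ≥0∞ :=
  ∑' n, maximalIdealValue v (R n)

/-- The sequence `Rₙ` switches strongly infinitely often: there are no `j` and no height one prime
`𝔭` of `Rⱼ` such that `⋃ Rₙ ⊆ (Rⱼ)_𝔭`. -/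
def SwitchesStronglyInfinitelyOften (R : ℕ → LocalSubring K) : Prop :=
  ¬ ∃ (j : ℕ) (p : Ideal (R j).toSubring) (_ : p.IsPrime), p.height = 1 ∧
      (⋃ n, ((R n).toSubring : Set K)) ⊆ (LocalSubring.ofPrime (R j).toSubring p).toSubring

/-- `R 0` is a regular local ring of dimension at least two with fraction field `K`, the valuation
ring `V` of the real valuation `v` birationally dominates `R 0` and is zero-dimensional over it, and
`R 0 ⊆ R 1 ⊆ ⋯` is the sequence of local quadratic transforms of `R 0` along `V`. -/
structure IsQuadraticSequenceAlong (v : AddValuation K (WithTop ℝ)) (R : ℕ → LocalSubring K) :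
    Prop where
  regular : IsRegularLocalRing (R 0).toSubring
  two_le_dim : 2 ≤ ringKrullDim (R 0).toSubring
  isFractionRing : IsFractionRing (R 0).toSubring K
  dominates : R 0 ≤ (valuationRing v).toLocalSubring
  zeroDimensional : IsZeroDimensionalOver (valuationRing v) (R 0)
  transform : ∀ n, IsQuadraticTransformAlong (valuationRing v) (R n) (R (n + 1))

end QuadraticTransforms

end

/-! Let $a_n$ generate $\mathfrak m_nV$ and put $\mu_n=v(a_n)=v(\mathfrak m_n)>0$. Dividing an
element of $\mathfrak m_n$ by $a_n$ gives an element of $R_{n+1}$ and lowers the value by $\mu_n$.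
Values on every $R_n$ are nonnegative, so a division process that never stops bounds the partial
sums of $s$.

If $s=\infty$ and $v(c)\le v(b)$, dividing $b$ and $c$ simultaneously must turn the denominator into
a unit (`exists_unit_of_valueSum_eq_top`), so $\bigcup R_n=V$. For a DVR the $\mu_n$ are bounded
below, so $s=\infty$. If two elements of $R_0$ have values $\alpha,\beta$ independent over $\mathbb
Z$, at each stage one of them can be divided with independence preserved, so $s\le\alpha+\beta$
(`valueSum_lt_top_of_not_commensurable`); hence $s=\infty$ forces rational rank one.

For strong switching, let $s=\infty$ and $V=\bigcup R_n\subseteq(R_j)_{\mathfrak p}$. As $V$ is a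
maximal proper subring of $K$, either $(R_j)_{\mathfrak p}=K$ and $\mathfrak p=0$, or $R_j=V$. The
latter is excluded by `IsQuadraticSequenceAlong.ne_valuationRing`: $V$ would be essentially of
finite type over $R_0$ with finite closed fibre, so Zariski's Main Theorem and the normality of
$R_0$ would give $V=R_0$, against $\dim R_0\ge2$. Normality comes from an induction on the dimension
showing that a regular local ring is a completely integrally closed domain.

The examples live on $\mathbb Q(x,y)$, with parameters $x_n=x_{n+1}^2(y_{n+1}+1)$,
$y_n=x_n^{m_n}x_{n+1}$. Each substitution strictly lowers a positive order of $f(0,y)$ once the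
power of $x$ is removed, so every nonzero polynomial becomes a power of some $x_j$ times a unit, and
$v(x_j)=2^{-j}$ defines a valuation with dyadic values. Passing from level $n$ to level $n+1$ takes
$m_n+2$ quadratic transforms, of total value $(m_n+1)2^{-n}$. Thus $m_n=0$ gives $s\le2$ and
$m_n=2^n$ gives $s=\infty$. -/

namespace QuadraticTransforms

variable {K : Type*} [Field K]

/-! ### Local rings dominated by $V$: fractions, units and values -/

theorem mem_ofPrime_iff {A : Subring K} {P : Ideal A} [P.IsPrime] {z : K} :
    z ∈ (LocalSubring.ofPrime A P).toSubring ↔ ∃ a s : A, s ∉ P ∧ z = (a : K) / s := by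
  constructor
  · intro hz
    obtain ⟨a, s, h⟩ := IsLocalization.exists_mk'_eq P.primeCompl
      (⟨z, hz⟩ : (LocalSubring.ofPrime A P).toSubring)
    refine ⟨a, s, s.2, ?_⟩
    have h1 := (IsLocalization.mk'_eq_iff_eq_mul).1 h
    have h2 : (a : K) = z * (s : A) := congrArg Subtype.val h1
    have hs : ((s : A) : K) ≠ 0 := by
      intro h0
      have h0' : (s : A) = 0 := Subtype.ext h0
      exact s.2 (h0' ▸ P.zero_mem)
    rw [h2, mul_div_cancel_right₀ _ hs]
  · rintro ⟨a, s, hs, rfl⟩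
    have hu : IsUnit (algebraMap A (LocalSubring.ofPrime A P).toSubring s) :=
      IsLocalization.map_units (M := P.primeCompl) _ ⟨s, hs⟩
    obtain ⟨t, ht⟩ := hu.exists_right_inv
    have ht' : (s : K) * t = 1 := congrArg Subtype.val ht
    have hs0 : (s : K) ≠ 0 := left_ne_zero_of_mul_eq_one ht'
    have : (a : K) / s = a * t := by
      rw [div_eq_iff hs0, mul_assoc, mul_comm (t : K), ht', mul_one]
    rw [this]
    exact mul_mem (LocalSubring.le_ofPrime A P a.2) t.2

theorem mem_toSubring_iff {v : AddValuation K (WithTop ℝ)} {x : K} :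
    x ∈ (valuationRing v).toLocalSubring.toSubring ↔ 0 ≤ v x := Iff.rfl

theorem map_inv_add {v : AddValuation K (WithTop ℝ)} {x : K} (hx : x ≠ 0) : v x + v x⁻¹ = 0 := by
  rw [← AddValuation.map_mul, mul_inv_cancel₀ hx, AddValuation.map_one]

theorem exists_real_eq {v : AddValuation K (WithTop ℝ)} {x : K} (hx : x ≠ 0) :
    ∃ r : ℝ, v x = r := by
  have := (AddValuation.ne_top_iff v).2 hx
  exact ⟨(v x).untop this, (WithTop.coe_untop _ this).symm⟩

theorem map_inv_eq {v : AddValuation K (WithTop ℝ)} {x : K} {r : ℝ} (h : v x = r) :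
    v x⁻¹ = ((-r : ℝ) : WithTop ℝ) := by
  have hx : x ≠ 0 := by rintro rfl; simp at h
  obtain ⟨s, hs⟩ := exists_real_eq (v := v) (inv_ne_zero hx)
  have := map_inv_add (v := v) hx
  rw [h, hs] at this
  norm_cast at this
  rw [hs]
  congr 1
  linarith

theorem map_div_eq {v : AddValuation K (WithTop ℝ)} {x y : K} {r s : ℝ} (h : v x = r)
    (h' : v y = s) : v (x / y) = ((r - s : ℝ) : WithTop ℝ) := by
  rw [div_eq_mul_inv, AddValuation.map_mul, h, map_inv_eq h', sub_eq_add_neg]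
  rfl

theorem mem_maximalIdeal_valuationRing {v : AddValuation K (WithTop ℝ)}
    {x : (valuationRing v).toLocalSubring.toSubring} :
    x ∈ maximalIdeal (valuationRing v).toLocalSubring.toSubring ↔ 0 < v (x : K) := by
  have hx : 0 ≤ v (x : K) := x.2
  rw [mem_maximalIdeal, mem_nonunits_iff, ← not_iff_not, not_not, not_lt]
  constructor
  · intro h
    obtain ⟨t, ht⟩ := h.exists_right_inv
    have ht' : (x : K) * t = 1 := congrArg Subtype.val ht
    have h2 : v (x : K) + v (t : K) = 0 := by
      rw [← AddValuation.map_mul, ht', AddValuation.map_one]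
    have ht0 : 0 ≤ v (t : K) := t.2
    exact h2 ▸ le_add_of_nonneg_right ht0
  · intro h
    have h0 : v (x : K) = 0 := le_antisymm h hx
    have hx0 : (x : K) ≠ 0 := by
      intro h; rw [h] at h0; simp at h0
    have := map_inv_add (v := v) hx0
    rw [h0, zero_add] at this
    have hm : (x : K)⁻¹ ∈ (valuationRing v).toLocalSubring.toSubring := this.ge
    exact IsUnit.of_mul_eq_one ⟨_, hm⟩ (Subtype.ext (mul_inv_cancel₀ hx0))

theorem mem_center_iff {v : AddValuation K (WithTop ℝ)} {A : Subring K}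
    {h : A ≤ (valuationRing v).toLocalSubring.toSubring} {x : A} :
    x ∈ center A (valuationRing v) h ↔ 0 < v (x : K) :=
  Ideal.mem_comap.trans mem_maximalIdeal_valuationRing

theorem nonneg_of_mem {v : AddValuation K (WithTop ℝ)} {R : LocalSubring K}
    (hR : R ≤ (valuationRing v).toLocalSubring) {x : K} (hx : x ∈ R.toSubring) : 0 ≤ v x :=
  hR.1 hx

theorem mem_maximalIdeal_iff {v : AddValuation K (WithTop ℝ)} {R : LocalSubring K}
    (hR : R ≤ (valuationRing v).toLocalSubring) {x : R.toSubring} :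
    x ∈ maximalIdeal R.toSubring ↔ 0 < v (x : K) := by
  obtain ⟨h, hl⟩ := hR
  have e : (maximalIdeal (valuationRing v).toLocalSubring.toSubring).comap
      (Subring.inclusion h) = maximalIdeal R.toSubring :=
    ((local_hom_TFAE (Subring.inclusion h)).out 0 4).1 hl
  rw [← e]
  exact Ideal.mem_comap.trans mem_maximalIdeal_valuationRing

theorem inv_mem_of_map_eq_zero {v : AddValuation K (WithTop ℝ)} {R : LocalSubring K}
    (hR : R ≤ (valuationRing v).toLocalSubring) {x : K} (hx : x ∈ R.toSubring) (h : v x = 0) :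
    x⁻¹ ∈ R.toSubring := by
  have : (⟨x, hx⟩ : R.toSubring) ∉ maximalIdeal R.toSubring := by
    rw [mem_maximalIdeal_iff hR]
    simp [h]
  rw [mem_maximalIdeal, mem_nonunits_iff, not_not] at this
  obtain ⟨t, ht⟩ := this.exists_right_inv
  have ht' : x * t = 1 := congrArg Subtype.val ht
  rw [inv_eq_of_mul_eq_one_right ht']
  exact t.2

theorem mem_ofPrime_center_iff {v : AddValuation K (WithTop ℝ)} {A : Subring K}
    {h : A ≤ (valuationRing v).toLocalSubring.toSubring} {z : K} :
    z ∈ (LocalSubring.ofPrime A (center A (valuationRing v) h)).toSubring ↔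
      ∃ a ∈ A, ∃ s ∈ A, v s = 0 ∧ z = a / s := by
  rw [mem_ofPrime_iff]
  constructor
  · rintro ⟨a, s, hs, rfl⟩
    refine ⟨a, a.2, s, s.2, ?_, rfl⟩
    rw [mem_center_iff, not_lt] at hs
    exact le_antisymm hs (h s.2)
  · rintro ⟨a, ha, s, hs, h0, rfl⟩
    refine ⟨⟨a, ha⟩, ⟨s, hs⟩, ?_, rfl⟩
    rw [mem_center_iff, h0]
    exact lt_irrefl _

theorem ofPrime_center_le {v : AddValuation K (WithTop ℝ)} {A : Subring K}
    (h : A ≤ (valuationRing v).toLocalSubring.toSubring) :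
    LocalSubring.ofPrime A (center A (valuationRing v) h) ≤ (valuationRing v).toLocalSubring := by
  have hle : (LocalSubring.ofPrime A (center A (valuationRing v) h)).toSubring ≤
      (valuationRing v).toLocalSubring.toSubring := by
    intro z hz
    obtain ⟨a, ha, s, hs, h0, rfl⟩ := mem_ofPrime_center_iff.1 hz
    have hs0 : s ≠ 0 := by rintro rfl; simp at h0
    have h1 := map_inv_add (v := v) hs0
    rw [h0, zero_add] at h1
    rw [mem_toSubring_iff, div_eq_mul_inv, AddValuation.map_mul, h1, add_zero]
    exact h ha
  refine ⟨hle, ⟨fun z hz => ?_⟩⟩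
  obtain ⟨a, ha, s, hs, h0, hzas⟩ := mem_ofPrime_center_iff.1 z.2
  have hs0 : s ≠ 0 := by rintro rfl; simp at h0
  have hz' : ¬ 0 < v (z : K) := fun hlt =>
    (mem_maximalIdeal _).1 (mem_maximalIdeal_valuationRing.2 hlt : Subring.inclusion hle z ∈ _) hz
  have hz0 : v (z : K) = 0 := le_antisymm (not_lt.1 hz') (hle z.2)
  have ha0 : v a = 0 := by
    have : a = z * s := by rw [hzas, div_mul_cancel₀ _ hs0]
    rw [this, AddValuation.map_mul, hz0, h0, add_zero]
  have hane : a ≠ 0 := by rintro rfl; simp at ha0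
  refine IsUnit.of_mul_eq_one ⟨s / a, mem_ofPrime_center_iff.2 ⟨s, hs, a, ha, ha0, rfl⟩⟩
    (Subtype.ext ?_)
  change (z : K) * (s / a) = 1
  rw [hzas]
  field_simp

theorem div_mem_blowupChart {R : LocalSubring K} (a : K) {b : R.toSubring}
    (hb : b ∈ maximalIdeal R.toSubring) : (b : K) / a ∈ blowupChart R a :=
  Subring.subset_closure (Or.inr ⟨⟨b, hb⟩, rfl⟩)

theorem le_blowupChart (R : LocalSubring K) (a : K) : R.toSubring ≤ blowupChart R a :=
  fun _ hx => Subring.subset_closure (Or.inl hx)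

/-- The chart lies in $V$, so every $b/a$ with $b\in\mathfrak m$ has nonnegative value and `a`
attains the infimum `maximalIdealValue`. The bounds on $s$ below use the transform only through this
division by `a`. -/
theorem IsQuadraticTransformAlong.exists_generator {v : AddValuation K (WithTop ℝ)}
    {R R' : LocalSubring K} (hR : R ≤ (valuationRing v).toLocalSubring)
    (h : IsQuadraticTransformAlong (valuationRing v) R R') :
    R.toSubring ≤ R'.toSubring ∧ R' ≤ (valuationRing v).toLocalSubring ∧
      ∃ a ∈ R.toSubring, ∃ μ : ℝ, v a = μ ∧ 0 < μ ∧ maximalIdealValue v R = ENNReal.ofReal μ ∧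
        ∀ b ∈ R.toSubring, 0 < v b → v a ≤ v b ∧ b / a ∈ R'.toSubring := by
  obtain ⟨a, ha0, hle, rfl⟩ := h
  refine ⟨(le_blowupChart R _).trans (LocalSubring.le_ofPrime _ _), ofPrime_center_le hle,
    a, (a : R.toSubring).2, ?_⟩
  obtain ⟨μ, hμ⟩ := exists_real_eq (v := v) ha0
  have hpos : 0 < v ((a : R.toSubring) : K) := (mem_maximalIdeal_iff hR).1 a.2
  have key : ∀ b ∈ R.toSubring, 0 < v b → v ((a : R.toSubring) : K) ≤ v b ∧
      b / ((a : R.toSubring) : K) ∈ blowupChart R ((a : R.toSubring) : K) := by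
    intro b hb hb0
    have hmem := div_mem_blowupChart (R := R) ((a : R.toSubring) : K) (b := ⟨b, hb⟩)
      ((mem_maximalIdeal_iff hR).2 hb0)
    refine ⟨?_, hmem⟩
    have h1 : 0 ≤ v (b / ((a : R.toSubring) : K)) := hle hmem
    have h2 : v b = v (b / ((a : R.toSubring) : K)) + v ((a : R.toSubring) : K) := by
      rw [← AddValuation.map_mul, div_mul_cancel₀ _ ha0]
    rw [h2]
    exact le_add_of_nonneg_left h1
  have hμ0 : 0 < μ := by rw [hμ] at hpos; exact_mod_cast hpos
  refine ⟨μ, hμ, hμ0, ?_, fun b hb hb0 =>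
    ⟨(key b hb hb0).1, LocalSubring.le_ofPrime _ _ (key b hb hb0).2⟩⟩
  refine le_antisymm ((iInf_le _ a).trans (by rw [hμ]; rfl)) (le_iInf fun x => ?_)
  have hx := (key x (x : R.toSubring).2 ((mem_maximalIdeal_iff hR).1 x.2)).1
  rw [hμ] at hx
  cases hvx : v ((x : R.toSubring) : K) with
  | top => exact le_top
  | coe r =>
    rw [hvx] at hx
    exact ENNReal.ofReal_le_ofReal (by exact_mod_cast hx)

/-! ### Division by the generators along the sequence -/

section Sequence

variable {v : AddValuation K (WithTop ℝ)} {R : ℕ → LocalSubring K}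

theorem IsQuadraticSequenceAlong.le_valuationRing (h : IsQuadraticSequenceAlong v R) (n : ℕ) :
    R n ≤ (valuationRing v).toLocalSubring := by
  induction n with
  | zero => exact h.dominates
  | succ n ih => exact ((h.transform n).exists_generator ih).2.1

theorem IsQuadraticSequenceAlong.mono (h : IsQuadraticSequenceAlong v R) :
    Monotone fun n => (R n).toSubring :=
  monotone_nat_of_le_succ fun n => ((h.transform n).exists_generator (h.le_valuationRing n)).1

theorem IsQuadraticSequenceAlong.exists_generators (h : IsQuadraticSequenceAlong v R) :
    ∃ (a : ℕ → K) (μ : ℕ → ℝ), (∀ n, v (a n) = μ n) ∧ (∀ n, 0 < μ n) ∧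
      (∀ n, a n ∈ (R n).toSubring) ∧
      valueSum v R = ∑' n, ENNReal.ofReal (μ n) ∧
      ∀ n, ∀ b ∈ (R n).toSubring, 0 < v b → v (a n) ≤ v b ∧ b / a n ∈ (R (n + 1)).toSubring := by
  have := fun n => ((h.transform n).exists_generator (h.le_valuationRing n)).2.2
  choose a ha μ h1 h2 h3 h4 using this
  exact ⟨a, μ, h1, h2, ha, tsum_congr h3, h4⟩

theorem tsum_ofReal_le_of_sum_le {μ : ℕ → ℝ} (h0 : ∀ n, 0 ≤ μ n) {c : ℝ}
    (h : ∀ n, ∑ i ∈ Finset.range n, μ i ≤ c) : ∑' n, ENNReal.ofReal (μ n) ≤ ENNReal.ofReal c := by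
  rw [ENNReal.tsum_eq_iSup_nat]
  refine iSup_le fun n => ?_
  rw [← ENNReal.ofReal_sum_of_nonneg fun i _ => h0 i]
  exact ENNReal.ofReal_le_ofReal (h n)

/-- If `s = ∞`, every element of `R₀` is a product of the generators `aᵢ`, `i < n`, and a unit of
`Rₙ`, for some `n`. -/
theorem exists_unit_of_valueSum_eq_top (h : IsQuadraticSequenceAlong v R)
    (hs : valueSum v R = ⊤) {b c : K} (hb : b ∈ (R 0).toSubring) (hc : c ∈ (R 0).toSubring)
    (hc0 : c ≠ 0) (hbc : v c ≤ v b) : ∃ n, b / c ∈ (R n).toSubring := by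
  obtain ⟨a, μ, hμ, hμ0, -, hsum, hdiv⟩ := h.exists_generators
  by_contra! hcon
  obtain ⟨γ, hγ⟩ := exists_real_eq (v := v) hc0
  -- Numerator and denominator are divided by the same `a i` at every stage. By `hcon` the
  -- denominator never becomes a unit, so its value stays positive and the division never stops.
  have key : ∀ n, ∃ b' ∈ (R n).toSubring, ∃ c' ∈ (R n).toSubring, b' / c' = b / c ∧
      v c' = ((γ - ∑ i ∈ Finset.range n, μ i : ℝ) : WithTop ℝ) ∧ v c' ≤ v b' := by
    intro n
    induction n with
    | zero => exact ⟨b, hb, c, hc, rfl, by simpa using hγ, hbc⟩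
    | succ n ih =>
      obtain ⟨b', hb', c', hc', hq, hv, hle⟩ := ih
      have hpos : 0 < v c' := by
        rcases (nonneg_of_mem (h.le_valuationRing n) hc').eq_or_lt with h0 | h0
        · exfalso
          refine hcon n ?_
          rw [← hq, div_eq_mul_inv]
          exact mul_mem hb' (inv_mem_of_map_eq_zero (h.le_valuationRing n) hc' h0.symm)
        · exact h0
      have ha0 : a n ≠ 0 := by
        intro h0
        have := hμ n
        simp [h0] at this
      refine ⟨b' / a n, (hdiv n b' hb' (hpos.trans_le hle)).2, c' / a n, (hdiv n c' hc' hpos).2,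
        ?_, ?_, ?_⟩
      · rw [div_div_div_cancel_right₀ ha0, hq]
      · rw [map_div_eq hv (hμ n), Finset.sum_range_succ]
        congr 1
        ring
      · rw [div_eq_mul_inv, div_eq_mul_inv, AddValuation.map_mul, AddValuation.map_mul]
        gcongr
  have hle : ∀ n, ∑ i ∈ Finset.range n, μ i ≤ γ := by
    intro n
    obtain ⟨b', -, c', hc', -, hv, -⟩ := key n
    have := nonneg_of_mem (h.le_valuationRing n) hc'
    rw [hv] at this
    have : 0 ≤ γ - ∑ i ∈ Finset.range n, μ i := by exact_mod_cast this
    linarith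
  have := tsum_ofReal_le_of_sum_le (fun n => (hμ0 n).le) hle
  rw [← hsum, hs] at this
  exact ENNReal.ofReal_ne_top (top_le_iff.1 this)

theorem IsQuadraticSequenceAlong.exists_div (h : IsQuadraticSequenceAlong v R) (z : K) :
    ∃ b ∈ (R 0).toSubring, ∃ c ∈ (R 0).toSubring, c ≠ 0 ∧ z = b / c := by
  have := h.isFractionRing
  obtain ⟨b, c, hc, rfl⟩ := IsFractionRing.div_surjective (A := (R 0).toSubring) z
  refine ⟨b, b.2, c, c.2, ?_, rfl⟩
  have := nonZeroDivisors.ne_zero hc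
  exact fun h0 => this (Subtype.ext h0)

theorem iUnion_eq_of_valueSum_eq_top (h : IsQuadraticSequenceAlong v R)
    (hs : valueSum v R = ⊤) : (⋃ n, ((R n).toSubring : Set K)) = (valuationRing v : Set K) := by
  apply Set.Subset.antisymm
  · exact Set.iUnion_subset fun n => (h.le_valuationRing n).1
  · intro z hz
    obtain ⟨b, hb, c, hc, hc0, rfl⟩ := h.exists_div z
    have hz' : 0 ≤ v (b / c) := hz
    have hbc : v c ≤ v b := by
      have : v b = v (b / c) + v c := by rw [← AddValuation.map_mul, div_mul_cancel₀ _ hc0]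
      rw [this]
      exact le_add_of_nonneg_left hz'
    obtain ⟨n, hn⟩ := exists_unit_of_valueSum_eq_top h hs hb hc hc0 hbc
    exact Set.mem_iUnion.2 ⟨n, hn⟩

theorem exists_pos_le_of_isDiscreteValuationRing (hV : IsDiscreteValuationRing (valuationRing v)) :
    ∃ ε : ℝ, 0 < ε ∧ ∀ z : K, 0 < v z → (ε : WithTop ℝ) ≤ v z := by
  obtain ⟨ϖ, hϖ⟩ := IsDiscreteValuationRing.exists_irreducible (valuationRing v)
  have hmax := hϖ.maximalIdeal_eq
  have hϖ0 : (ϖ : K) ≠ 0 := fun h0 => hϖ.ne_zero (Subtype.ext h0)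
  obtain ⟨ε, hε⟩ := exists_real_eq (v := v) hϖ0
  have hpos : 0 < v (ϖ : K) := by
    have : (⟨ϖ, ϖ.2⟩ : (valuationRing v).toLocalSubring.toSubring) ∈ maximalIdeal _ := by
      rw [mem_maximalIdeal]
      exact hϖ.not_isUnit
    exact mem_maximalIdeal_valuationRing.1 this
  refine ⟨ε, by rw [hε] at hpos; exact_mod_cast hpos, fun z hz => ?_⟩
  have hm : (⟨z, hz.le⟩ : valuationRing v) ∈ maximalIdeal (valuationRing v) :=
    (mem_maximalIdeal_valuationRing (v := v) (x := ⟨z, hz.le⟩)).2 hz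
  rw [hmax, Ideal.mem_span_singleton] at hm
  obtain ⟨t, ht⟩ := hm
  have ht' : z = ϖ * t := congrArg Subtype.val ht
  have ht0 : 0 ≤ v (t : K) := t.2
  rw [ht', AddValuation.map_mul, ← hε]
  exact le_add_of_nonneg_right ht0

theorem valueSum_eq_top_of_isDiscreteValuationRing (h : IsQuadraticSequenceAlong v R)
    (hV : IsDiscreteValuationRing (valuationRing v)) : valueSum v R = ⊤ := by
  obtain ⟨ε, hε0, hε⟩ := exists_pos_le_of_isDiscreteValuationRing hV
  obtain ⟨a, μ, hμ, hμ0, -, hsum, -⟩ := h.exists_generators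
  have hle : ∀ n, ε ≤ μ n := by
    intro n
    have := hε (a n) (by rw [hμ]; exact_mod_cast hμ0 n)
    rw [hμ] at this
    exact_mod_cast this
  rw [hsum]
  refine top_le_iff.1 ?_
  calc (⊤ : ℝ≥0∞) = ∑' _ : ℕ, ENNReal.ofReal ε :=
        (ENNReal.tsum_const_eq_top_of_ne_zero (by simpa using hε0)).symm
    _ ≤ _ := ENNReal.tsum_le_tsum fun n => ENNReal.ofReal_le_ofReal (hle n)

/-- Two real numbers are linearly dependent over `ℤ`. -/
def Commensurable (α β : ℝ) : Prop := ∃ m n : ℤ, (m ≠ 0 ∨ n ≠ 0) ∧ m * α + n * β = 0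

/-- At each stage one element of the current pair is divided by `a n`, chosen so that the two values
stay independent. Their sum drops by exactly `μ n` and stays nonnegative, which yields the bound `α
+ β`. -/
theorem valueSum_lt_top_of_not_commensurable (h : IsQuadraticSequenceAlong v R) {x y : K}
    (hx : x ∈ (R 0).toSubring) (hy : y ∈ (R 0).toSubring) {α β : ℝ} (hα : v x = α) (hβ : v y = β)
    (hαβ : ¬ Commensurable α β) : valueSum v R < ⊤ := by
  obtain ⟨a, μ, hμ, hμ0, -, hsum, hdiv⟩ := h.exists_generators
  have key : ∀ n, ∃ x' ∈ (R n).toSubring, ∃ y' ∈ (R n).toSubring, ∃ α' β' : ℝ, v x' = α' ∧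
      v y' = β' ∧ ¬ Commensurable α' β' ∧ α' + β' = α + β - ∑ i ∈ Finset.range n, μ i := by
    intro n
    induction n with
    | zero => exact ⟨x, hx, y, hy, α, β, hα, hβ, hαβ, by simp⟩
    | succ n ih =>
      obtain ⟨x', hx', y', hy', α', β', hα', hβ', hc, hs⟩ := ih
      have hα0 : 0 < α' := by
        have h1 := nonneg_of_mem (h.le_valuationRing n) hx'
        rw [hα'] at h1
        have h1 : 0 ≤ α' := by exact_mod_cast h1
        refine h1.lt_of_ne fun h0 => hc ⟨1, 0, by simp, by simp [← h0]⟩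
      have hβ0 : 0 < β' := by
        have h1 := nonneg_of_mem (h.le_valuationRing n) hy'
        rw [hβ'] at h1
        have h1 : 0 ≤ β' := by exact_mod_cast h1
        refine h1.lt_of_ne fun h0 => hc ⟨0, 1, by simp, by simp [← h0]⟩
      obtain ⟨hx1, hx2⟩ := hdiv n x' hx' (by rw [hα']; exact_mod_cast hα0)
      obtain ⟨hy1, hy2⟩ := hdiv n y' hy' (by rw [hβ']; exact_mod_cast hβ0)
      by_cases hc1 : Commensurable (α' - μ n) β'
      · by_cases hc2 : Commensurable α' (β' - μ n)
        · exfalso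
          obtain ⟨p, q, hpq, e1⟩ := hc1
          obtain ⟨r, t, hrt, e2⟩ := hc2
          have hp : p ≠ 0 := by
            rintro rfl
            exact hc ⟨0, q, by simpa using hpq, by simpa using e1⟩
          have ht : t ≠ 0 := by
            rintro rfl
            exact hc ⟨r, 0, by simpa using hrt, by simpa using e2⟩
          -- Eliminating `μ n` leaves a relation between `α'` and `β'`, which must be trivial. Both
          -- original relations then say `μ n = α' + β'`, impossible since `μ n ≤ α'` and `0 < β'`.
          have e3 : ((p * t - p * r : ℤ) : ℝ) * α' + ((q * t - p * t : ℤ) : ℝ) * β' = 0 := by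
            push_cast
            linear_combination (t : ℝ) * e1 - (p : ℝ) * e2
          have h4 : p * t - p * r = 0 ∧ q * t - p * t = 0 := by
            by_contra hne
            exact hc ⟨_, _, by tauto, e3⟩
          have htr : t = r := by
            have : p * (t - r) = 0 := by linear_combination h4.1
            have := (mul_eq_zero.1 this).resolve_left hp
            linarith
          have hpq' : q = p := by
            have : t * (q - p) = 0 := by linear_combination h4.2
            have := (mul_eq_zero.1 this).resolve_left ht
            linarith
          have e5 : (p : ℝ) * (α' + β' - μ n) = 0 := by
            rw [hpq'] at e1
            linear_combination e1
          have e6 := (mul_eq_zero.1 e5).resolve_left (by exact_mod_cast hp)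
          rw [hμ, hα'] at hx1
          have : μ n ≤ α' := by exact_mod_cast hx1
          linarith
        · exact ⟨x', h.mono n.le_succ hx', _, hy2, α', β' - μ n, hα', map_div_eq hβ' (hμ n), hc2,
            by rw [Finset.sum_range_succ]; linarith⟩
      · exact ⟨_, hx2, y', h.mono n.le_succ hy', α' - μ n, β', map_div_eq hα' (hμ n), hβ', hc1,
          by rw [Finset.sum_range_succ]; linarith⟩
  have hle : ∀ n, ∑ i ∈ Finset.range n, μ i ≤ α + β := by
    intro n
    obtain ⟨x', hx', y', hy', α', β', hα', hβ', -, hs⟩ := key n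
    have h1 := nonneg_of_mem (h.le_valuationRing n) hx'
    have h2 := nonneg_of_mem (h.le_valuationRing n) hy'
    rw [hα'] at h1
    rw [hβ'] at h2
    have h1 : 0 ≤ α' := by exact_mod_cast h1
    have h2 : 0 ≤ β' := by exact_mod_cast h2
    linarith
  rw [hsum]
  exact (tsum_ofReal_le_of_sum_le (fun n => (hμ0 n).le) hle).trans_lt ENNReal.ofReal_lt_top

end Sequence

/-! ### Rational rank -/

theorem Commensurable.exists_rat {α β : ℝ} (h : Commensurable α β) (hβ : β ≠ 0) :
    ∃ r : ℚ, α = r * β := by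
  obtain ⟨m, n, hmn, e⟩ := h
  have hm : m ≠ 0 := by
    rintro rfl
    have hn : n ≠ 0 := by simpa using hmn
    simp [hn, hβ] at e
  have hm' : (m : ℝ) ≠ 0 := by exact_mod_cast hm
  refine ⟨-n / m, ?_⟩
  push_cast
  field_simp
  linear_combination e

/-- If $\gamma=(p/d)\gamma_0$ then $d\gamma=p\gamma_0$ in $\Gamma$, and moving $d$ across the tensor
product turns $q\otimes\gamma$ into $(qp/d)\otimes\gamma_0$. -/
theorem rank_le_one_of_commensurable (Γ : AddSubgroup ℝ) (γ₀ : ℝ) (h₀ : γ₀ ∈ Γ)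
    (h : ∀ γ ∈ Γ, ∃ r : ℚ, γ = r * γ₀) : Module.rank ℚ (ℚ ⊗[ℤ] Γ) ≤ 1 := by
  rw [rank_le_one_iff]
  refine ⟨(1 : ℚ) ⊗ₜ[ℤ] (⟨γ₀, h₀⟩ : Γ), fun x => ?_⟩
  induction x using TensorProduct.induction_on with
  | zero => exact ⟨0, zero_smul _ _⟩
  | tmul q γ =>
    obtain ⟨r, hr⟩ := h γ γ.2
    refine ⟨q * r, ?_⟩
    have e : (r.den : ℤ) • γ = r.num • (⟨γ₀, h₀⟩ : Γ) := by
      apply Subtype.ext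
      have h1 : (r : ℝ) * r.den = r.num := by exact_mod_cast Rat.mul_den_eq_num r
      simp only [AddSubgroup.coe_zsmul, zsmul_eq_mul]
      rw [hr, ← h1]
      push_cast
      ring
    have hd : (r.den : ℚ) ≠ 0 := by exact_mod_cast r.den_ne_zero
    have hq : q = (r.den : ℤ) • (q / r.den) := by
      rw [zsmul_eq_mul]
      push_cast
      field_simp
    conv_rhs => rw [hq, TensorProduct.smul_tmul, e, ← TensorProduct.smul_tmul]
    rw [TensorProduct.smul_tmul']
    congr 1
    rw [zsmul_eq_mul, smul_eq_mul, mul_one]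
    conv_lhs => rw [← Rat.num_div_den r]
    ring
  | add x y hx hy =>
    obtain ⟨a, rfl⟩ := hx
    obtain ⟨b, rfl⟩ := hy
    exact ⟨a + b, add_smul _ _ _⟩

/-- The multiplication map $q\otimes\gamma\mapsto q\gamma\in\mathbb R$ detects $1\otimes\gamma$. -/
theorem rank_ne_zero_of_ne_zero (Γ : AddSubgroup ℝ) (γ : Γ) (h : γ ≠ 0) :
    Module.rank ℚ (ℚ ⊗[ℤ] Γ) ≠ 0 := by
  intro h0
  have hs := rank_zero_iff.1 h0
  let f : ℚ ⊗[ℤ] Γ →ₗ[ℤ] ℝ := LinearMap.mul' ℤ ℝ ∘ₗ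
    TensorProduct.map (algebraMap ℚ ℝ).toAddMonoidHom.toIntLinearMap Γ.subtype.toIntLinearMap
  have h1 : f ((1 : ℚ) ⊗ₜ γ) = γ := by
    change (algebraMap ℚ ℝ 1) * (γ : ℝ) = γ
    rw [map_one, one_mul]
  rw [Subsingleton.elim ((1 : ℚ) ⊗ₜ[ℤ] γ) 0, map_zero] at h1
  exact h (Subtype.ext h1.symm)

theorem rank_eq_one (Γ : AddSubgroup ℝ) (γ₀ : ℝ) (h₀ : γ₀ ∈ Γ) (hne : γ₀ ≠ 0)
    (h : ∀ γ ∈ Γ, ∃ r : ℚ, γ = r * γ₀) : Module.rank ℚ (ℚ ⊗[ℤ] Γ) = 1 :=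
  le_antisymm (rank_le_one_of_commensurable Γ γ₀ h₀ h) <| Cardinal.one_le_iff_ne_zero.2 <|
    rank_ne_zero_of_ne_zero Γ ⟨γ₀, h₀⟩ fun h0 => hne (congrArg Subtype.val h0)

variable {v : AddValuation K (WithTop ℝ)} {R : ℕ → LocalSubring K}

/-- Unless $s$ is finite, all finite values on $R_0$ are rational multiples of $\mu_0$; since $K$ is
the fraction field of $R_0$, so are all elements of the value group. -/
theorem IsQuadraticSequenceAlong.rationalRank_eq_one_or (h : IsQuadraticSequenceAlong v R) :
    rationalRank v = 1 ∨ valueSum v R < ⊤ := by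
  rw [or_iff_not_imp_right]
  intro hs
  have hcomm : ∀ x ∈ (R 0).toSubring, ∀ y ∈ (R 0).toSubring, ∀ α β : ℝ, v x = α → v y = β →
      Commensurable α β := by
    intro x hx y hy α β hα hβ
    by_contra hc
    exact hs (valueSum_lt_top_of_not_commensurable h hx hy hα hβ hc)
  obtain ⟨a, μ, hμ, hμ0, ha, -, -⟩ := h.exists_generators
  refine rank_eq_one (valueGroup v) (μ 0) ⟨a 0, hμ 0⟩ (hμ0 0).ne' ?_
  rintro γ ⟨z, hz⟩
  obtain ⟨b, hb, c, hc, hc0, rfl⟩ := h.exists_div z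
  have hb0 : b ≠ 0 := by rintro rfl; simp at hz
  obtain ⟨β, hβ⟩ := exists_real_eq (v := v) hb0
  obtain ⟨δ, hδ⟩ := exists_real_eq (v := v) hc0
  obtain ⟨r, rfl⟩ := (hcomm b hb _ (ha 0) _ _ hβ (hμ 0)).exists_rat (hμ0 0).ne'
  obtain ⟨s, rfl⟩ := (hcomm c hc _ (ha 0) _ _ hδ (hμ 0)).exists_rat (hμ0 0).ne'
  rw [map_div_eq hβ hδ] at hz
  refine ⟨r - s, ?_⟩
  have : r * μ 0 - s * μ 0 = γ := by exact_mod_cast hz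
  rw [← this]
  push_cast
  ring

theorem valueSum_lt_top_of_two_le_rationalRank (h : IsQuadraticSequenceAlong v R)
    (h2 : 2 ≤ rationalRank v) : valueSum v R < ⊤ := by
  refine h.rationalRank_eq_one_or.resolve_left fun h1 => ?_
  rw [h1] at h2
  exact absurd h2 (by simp)

theorem rationalRank_eq_one_of_valueSum_eq_top (h : IsQuadraticSequenceAlong v R)
    (hs : valueSum v R = ⊤) : rationalRank v = 1 :=
  h.rationalRank_eq_one_or.resolve_right hs.not_lt

/-! ### Regular local rings are integrally closed domains -/

/-- A domain is completely integrally closed if it contains every element `b / c` of its fraction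
field which is almost integral over it. -/
def IsCompletelyIntegrallyClosed (R : Type*) [CommRing R] : Prop :=
  ∀ s b c : R, s ≠ 0 → c ≠ 0 → (∀ n, c ^ n ∣ s * b ^ n) → c ∣ b

/-- Almost integrality of $b/c$ passes to $b/c-e$: in the binomial expansion the term containing
$b^i$ gets $c^i$ from the hypothesis and $c^{n-i}$ from its other factor. -/
theorem pow_dvd_mul_sub_pow {R : Type*} [CommRing R] {s b c e : R}
    (h : ∀ n, c ^ n ∣ s * b ^ n) (n : ℕ) : c ^ n ∣ s * (b - c * e) ^ n := by
  rw [sub_eq_add_neg, add_pow, Finset.mul_sum]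
  refine Finset.dvd_sum fun i hi => ?_
  have hin : i ≤ n := Nat.lt_succ_iff.1 (Finset.mem_range.1 hi)
  have h1 : c ^ n = c ^ i * c ^ (n - i) := by rw [← pow_add, Nat.add_sub_cancel' hin]
  have h2 : s * (b ^ i * (-(c * e)) ^ (n - i) * (n.choose i : R)) =
      (s * b ^ i) * c ^ (n - i) * ((-e) ^ (n - i) * (n.choose i : R)) := by
    rw [← mul_neg, mul_pow]
    ring
  rw [h1, h2]
  exact Dvd.dvd.mul_right (mul_dvd_mul_right (h i) _) _

/-- This is Krull's intersection theorem in $R/(c)$. -/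
theorem dvd_of_forall_exists_add_pow {R : Type*} [CommRing R] [IsLocalRing R] [IsNoetherianRing R]
    {x b c : R} (hx : x ∈ maximalIdeal R) (h : ∀ N : ℕ, ∃ e y, b = c * e + x ^ N * y) : c ∣ b := by
  have hbot := Ideal.iInf_pow_smul_eq_bot_of_isLocalRing (R := R) (M := R ⧸ Ideal.span {c})
    (maximalIdeal R) (Ideal.IsPrime.ne_top inferInstance)
  have hmem : Ideal.Quotient.mk (Ideal.span {c}) b ∈
      ⨅ i : ℕ, maximalIdeal R ^ i • (⊤ : Submodule R (R ⧸ Ideal.span {c})) := by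
    rw [Submodule.mem_iInf]
    intro N
    obtain ⟨e, y, rfl⟩ := h N
    have h1 : Ideal.Quotient.mk (Ideal.span {c}) (c * e + x ^ N * y) =
        x ^ N • Ideal.Quotient.mk (Ideal.span {c}) y := by
      rw [map_add, Ideal.Quotient.eq_zero_iff_mem.2
        (Ideal.mem_span_singleton.2 (dvd_mul_right c e)), zero_add, map_mul]
      rfl
    rw [h1]
    exact Submodule.smul_mem_smul (Ideal.pow_mem_pow hx N) trivial
  rw [hbot, Submodule.mem_bot, Ideal.Quotient.eq_zero_iff_mem, Ideal.mem_span_singleton] at hmem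
  exact hmem

/-- Suppose first that $x$ divides neither $s$ nor $c$. The hypothesis on $R/(x)$ gives $b=ce+xy$.
By `pow_dvd_mul_sub_pow`, $c^n\mid s(xy)^n$, and $x^n$ cancels because $x$ is a prime not dividing
$c$; so $y$ satisfies the same condition as $b$. Iterating, $b\in cR+x^NR$ for all $N$, hence $c\mid
b$. The general case follows by splitting off powers of $x$. -/
theorem IsCompletelyIntegrallyClosed.of_quotient_prime {R : Type*} [CommRing R] [IsLocalRing R]
    [IsNoetherianRing R] [IsDomain R] {x : R} (hx : x ∈ maximalIdeal R) (hp : Prime x)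
    (hq : IsCompletelyIntegrallyClosed (R ⧸ Ideal.span {x})) : IsCompletelyIntegrallyClosed R := by
  have hq' : ∀ s b c : R, ¬ x ∣ s → ¬ x ∣ c → (∀ n, c ^ n ∣ s * b ^ n) → ∃ e y, b = c * e + x * y := by
    intro s b c hs hc h
    have hz : ∀ r : R, ¬ x ∣ r → Ideal.Quotient.mk (Ideal.span {x}) r ≠ 0 := by
      intro r hr h0
      exact hr (Ideal.mem_span_singleton.1 (Ideal.Quotient.eq_zero_iff_mem.1 h0))
    obtain ⟨e, he⟩ := hq (Ideal.Quotient.mk _ s) (Ideal.Quotient.mk _ b) (Ideal.Quotient.mk _ c)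
      (hz s hs) (hz c hc) fun n => by
        simpa using map_dvd (Ideal.Quotient.mk (Ideal.span {x})) (h n)
    obtain ⟨e, rfl⟩ := Ideal.Quotient.mk_surjective e
    rw [← map_mul, Ideal.Quotient.eq, Ideal.mem_span_singleton] at he
    obtain ⟨y, hy⟩ := he
    exact ⟨e, y, by rw [← hy]; ring⟩
  have main : ∀ c : R, ¬ x ∣ c → ∀ N : ℕ, ∀ s b : R, ¬ x ∣ s → (∀ n, c ^ n ∣ s * b ^ n) →
      ∃ e y, b = c * e + x ^ N * y := by
    intro c hc N
    induction N with
    | zero => exact fun s b _ _ => ⟨0, b, by simp⟩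
    | succ N ih =>
      intro s b hs h
      obtain ⟨e, y, hb⟩ := hq' s b c hs hc h
      have hxy : x * y = b - c * e := by rw [hb]; ring
      obtain ⟨e', y', hy⟩ := ih s y hs fun n => by
        have h1 := pow_dvd_mul_sub_pow (e := e) h n
        rw [← hxy, mul_pow, mul_left_comm] at h1
        obtain ⟨w, hw⟩ := h1
        obtain ⟨w', rfl⟩ := hp.pow_dvd_of_dvd_mul_left n (fun h => hc (hp.dvd_of_dvd_pow h))
          (Dvd.intro _ hw)
        exact ⟨w', mul_left_cancel₀ (pow_ne_zero n hp.ne_zero) (by rw [hw]; ring)⟩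
      exact ⟨e + x * e', y', by rw [hb, hy]; ring⟩
  have hfactor : ∀ r : R, r ≠ 0 → ∃ n a, ¬ x ∣ a ∧ r = x ^ n * a :=
    fun r hr => WfDvdMonoid.max_power_factor hr hp.irreducible
  intro s b c hs hc h
  by_cases hb : b = 0
  · exact hb ▸ dvd_zero c
  obtain ⟨t, s', hs', rfl⟩ := hfactor s hs
  obtain ⟨l, b', hb', rfl⟩ := hfactor b hb
  obtain ⟨k, c', hc', rfl⟩ := hfactor c hc
  have hkl : k ≤ l := by
    -- Comparing powers of `x` at exponent `t + 1` gives $k(t+1)\le t+l(t+1)$, so $k\le l$: the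
    -- contribution `t` of `s` is too small to make up one further multiple of `t + 1`.
    have h1 := h (t + 1)
    have h2 : x ^ (k * (t + 1)) ∣ (s' * b' ^ (t + 1)) * x ^ (t + l * (t + 1)) := by
      refine (Dvd.intro (c' ^ (t + 1)) ?_).trans (h1.trans (dvd_of_eq ?_))
      · rw [mul_pow, pow_mul]
      · rw [mul_pow, pow_add x, pow_mul]
        ring
    have h3 := hp.pow_dvd_of_dvd_mul_left _
      (fun h => (hp.dvd_or_dvd h).elim hs' fun h => hb' (hp.dvd_of_dvd_pow h)) h2
    have h4 := (pow_dvd_pow_iff hp.ne_zero hp.not_isUnit).1 h3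
    by_contra hlt
    have : (l + 1) * (t + 1) ≤ k * (t + 1) := Nat.mul_le_mul_right _ (by omega)
    rw [add_mul, one_mul] at this
    omega
  obtain ⟨i, rfl⟩ := Nat.exists_eq_add_of_le hkl
  rw [pow_add, mul_assoc]
  refine mul_dvd_mul_left _ (dvd_of_forall_exists_add_pow hx fun N => ?_)
  refine main c' hc' N s' (x ^ i * b') hs' fun n => ?_
  have h1 := h n
  have h2 : (x ^ k * c') ^ n ∣ (s' * (x ^ i * b') ^ n) * x ^ (t + k * n) := by
    refine h1.trans (dvd_of_eq ?_)
    rw [pow_add, pow_add, pow_mul]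
    ring
  obtain ⟨w, hw⟩ := h2
  have h3 : x ^ t ∣ c' ^ n * w := by
    refine ⟨s' * (x ^ i * b') ^ n, mul_left_cancel₀ (pow_ne_zero (k * n) hp.ne_zero) ?_⟩
    calc x ^ (k * n) * (c' ^ n * w) = (x ^ k * c') ^ n * w := by rw [mul_pow, pow_mul]; ring
      _ = _ := by rw [← hw, pow_add]; ring
  obtain ⟨w', rfl⟩ := hp.pow_dvd_of_dvd_mul_left _ (fun h => hc' (hp.dvd_of_dvd_pow h)) h3
  refine ⟨w', mul_left_cancel₀ (pow_ne_zero (t + k * n) hp.ne_zero) ?_⟩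
  rw [mul_comm, hw, mul_pow, pow_add, pow_mul]
  ring

/-- Let $q$ be a minimal prime inside $(x)$. If $xz\in q$ then $z\in q$, because $x\notin q$. Thus
$q\subseteq\mathfrak mq$, and Nakayama gives $q=0$. -/
theorem isDomain_of_prime_span {R : Type*} [CommRing R] [IsLocalRing R] [IsNoetherianRing R] {x : R}
    (hx : x ∈ maximalIdeal R) (hp : (Ideal.span {x}).IsPrime) (hmin : ∀ q ∈ minimalPrimes R, x ∉ q) :
    IsDomain R := by
  obtain ⟨q, hq, hqx⟩ := Ideal.exists_minimalPrimes_le (I := (⊥ : Ideal R)) (J := Ideal.span {x})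
    bot_le
  have hqp : q.IsPrime := hq.1.1
  have hle : q ≤ maximalIdeal R • q := by
    intro y hy
    obtain ⟨z, rfl⟩ := Ideal.mem_span_singleton.1 (hqx hy)
    exact Submodule.smul_mem_smul hx ((hqp.mem_or_mem hy).resolve_left (hmin q hq))
  have hq0 := Submodule.eq_bot_of_le_smul_of_le_jacobson_bot (maximalIdeal R) q
    (IsNoetherian.noetherian q) hle (IsLocalRing.maximalIdeal_le_jacobson _)
  rw [hq0] at hqp
  exact IsDomain.of_bot_isPrime R

/-- Prime avoidance provides $x\in\mathfrak m\setminus\mathfrak m^2$ outside all minimal primes. As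
$x\notin\mathfrak m^2$, some generator of $\mathfrak m$ has a unit coefficient in $x$ and becomes
redundant modulo $x$, so the embedding dimension drops; the dimension drops by at most one, which
forces equality. -/
theorem exists_isRegularLocalRing_quotient {R : Type*} [CommRing R] [IsRegularLocalRing R] {d : ℕ}
    (hd : ringKrullDim R = (d + 1 : ℕ)) :
    ∃ x ∈ maximalIdeal R, (∀ q ∈ minimalPrimes R, x ∉ q) ∧
      ∃ _ : IsRegularLocalRing (R ⧸ Ideal.span {x}), ringKrullDim (R ⧸ Ideal.span {x}) = d := by
  classical
  have hfg : (maximalIdeal R).FG := IsNoetherian.noetherian _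
  have hrank : (maximalIdeal R).spanFinrank = d + 1 := by
    have := IsRegularLocalRing.spanFinrank_maximalIdeal (R := R)
    rw [hd] at this
    exact_mod_cast this
  obtain ⟨x, hxm, hx2, hxmin⟩ : ∃ x ∈ maximalIdeal R, x ∉ maximalIdeal R ^ 2 ∧
      ∀ q ∈ minimalPrimes R, x ∉ q := by
    by_contra! hcon
    have hfin := minimalPrimes.finite_of_isNoetherianRing R
    -- Prime avoidance tolerates two ideals that need not be prime; both slots are given to
    -- $\mathfrak m^2$.
    have := (Ideal.subset_union_prime (s := insert (maximalIdeal R ^ 2) hfin.toFinset)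
      (f := fun I : Ideal R => I) (maximalIdeal R ^ 2) (maximalIdeal R ^ 2)
      (by
        intro q hq h1 _
        have hq' := (Finset.mem_insert.1 hq).resolve_left h1
        exact (hfin.mem_toFinset.1 hq').1.1) (I := maximalIdeal R)).1 (by
        intro x hx
        simp only [Set.mem_iUnion]
        by_cases h2 : x ∈ maximalIdeal R ^ 2
        · exact ⟨_, by simp, h2⟩
        · obtain ⟨q, hq, hxq⟩ := hcon x hx h2
          exact ⟨q, by simp [hq], hxq⟩)
    obtain ⟨q, hq, hle⟩ := this
    rcases Finset.mem_insert.1 hq with rfl | hq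
    · have h0 := Submodule.eq_bot_of_le_smul_of_le_jacobson_bot (maximalIdeal R) (maximalIdeal R)
        hfg (by rwa [smul_eq_mul, ← pow_two]) (IsLocalRing.maximalIdeal_le_jacobson _)
      rw [(Submodule.spanFinrank_eq_zero_iff_eq_bot hfg).2 h0] at hrank
      omega
    · rw [hfin.mem_toFinset] at hq
      have hqp : q.IsPrime := hq.1.1
      have heq : maximalIdeal R = q := le_antisymm hle (IsLocalRing.le_maximalIdeal hqp.ne_top)
      have h0 : (maximalIdeal R).height = 0 := Ideal.height_eq_zero_iff.2 (heq ▸ hq)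
      rw [← maximalIdeal_height_eq_ringKrullDim, h0] at hd
      have : (0 : ℕ∞) = (d + 1 : ℕ) := by exact_mod_cast hd
      have : 0 = d + 1 := by exact_mod_cast this
      omega
  refine ⟨x, hxm, hxmin, ?_⟩
  have hne : Ideal.span {x} ≠ ⊤ := fun h => by
    rw [Ideal.span_singleton_eq_top] at h
    exact (mem_maximalIdeal x).1 hxm h
  have : Nontrivial (R ⧸ Ideal.span {x}) := Ideal.Quotient.nontrivial_iff.2 hne
  have hloc : IsLocalRing (R ⧸ Ideal.span {x}) :=
    .of_surjective' (Ideal.Quotient.mk _) Ideal.Quotient.mk_surjective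
  have hlh : IsLocalHom (Ideal.Quotient.mk (Ideal.span {x})) :=
    .of_surjective _ Ideal.Quotient.mk_surjective
  have hcomap : (maximalIdeal (R ⧸ Ideal.span {x})).comap (Ideal.Quotient.mk (Ideal.span {x})) =
      maximalIdeal R := ((local_hom_TFAE (Ideal.Quotient.mk (Ideal.span {x}))).out 0 4).1 hlh
  have hmap : (maximalIdeal R).map (Ideal.Quotient.mk (Ideal.span {x})) =
      maximalIdeal (R ⧸ Ideal.span {x}) := by
    rw [← hcomap, Ideal.map_comap_of_surjective _ Ideal.Quotient.mk_surjective]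
  have hle : (maximalIdeal (R ⧸ Ideal.span {x})).spanFinrank ≤ d := by
    have hfinG := Submodule.FG.finite_generators hfg
    have hspan : Ideal.span (maximalIdeal R).generators = maximalIdeal R :=
      Submodule.span_generators _
    obtain ⟨f, -, hf⟩ := Submodule.mem_span_finset.1 (show x ∈ Submodule.span R
      (hfinG.toFinset : Set R) by rw [hfinG.coe_toFinset]; exact hspan.ge hxm)
    obtain ⟨g, hg, hgu⟩ : ∃ g ∈ hfinG.toFinset, f g ∉ maximalIdeal R := by
      by_contra! hall
      refine hx2 (hf ▸ sum_mem fun g hg => ?_)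
      rw [pow_two, smul_eq_mul]
      exact Ideal.mul_mem_mul (hall g hg)
        (hspan ▸ Ideal.subset_span (hfinG.mem_toFinset.1 hg))
    have hgu' : IsUnit (f g) := by
      rwa [mem_maximalIdeal, mem_nonunits_iff, not_not] at hgu
    have hG : maximalIdeal (R ⧸ Ideal.span {x}) = Ideal.span (Ideal.Quotient.mk (Ideal.span {x}) ''
        ((maximalIdeal R).generators \ {g})) := by
      rw [← hmap]
      conv_lhs => rw [← hspan]
      rw [Ideal.map_span]
      apply le_antisymm
      · rw [Ideal.span_le]
        rintro _ ⟨h, hh, rfl⟩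
        by_cases hhg : h = g
        · subst hhg
          rw [SetLike.mem_coe, ← Ideal.unit_mul_mem_iff_mem _ (hgu'.map (Ideal.Quotient.mk _)),
            ← map_mul]
          have h0 : Ideal.Quotient.mk (Ideal.span {x}) (∑ a ∈ hfinG.toFinset, f a • a) = 0 := by
            rw [hf]
            exact Ideal.Quotient.eq_zero_iff_mem.2 (Ideal.mem_span_singleton_self x)
          rw [← Finset.add_sum_erase _ _ hg, map_add, smul_eq_mul] at h0
          rw [eq_neg_of_add_eq_zero_left h0, map_sum]
          refine neg_mem (sum_mem fun i hi => ?_)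
          rw [smul_eq_mul, map_mul]
          refine Ideal.mul_mem_left _ _ (Ideal.subset_span ⟨i, ⟨?_, ?_⟩, rfl⟩)
          · exact hfinG.mem_toFinset.1 (Finset.mem_of_mem_erase hi)
          · exact Finset.ne_of_mem_erase hi
        · exact Ideal.subset_span ⟨h, ⟨hh, hhg⟩, rfl⟩
      · exact Ideal.span_mono (Set.image_mono Set.sdiff_subset)
    rw [hG]
    refine (Submodule.spanFinrank_span_le_ncard_of_finite ((hfinG.sdiff).image _)).trans ?_
    refine (Set.ncard_image_le hfinG.sdiff).trans ?_
    have := Set.ncard_sdiff_singleton_add_one (hfinG.mem_toFinset.1 hg) hfinG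
    rw [Submodule.FG.generators_ncard hfg, hrank] at this
    omega
  have hge : (d : WithBot ℕ∞) ≤ ringKrullDim (R ⧸ Ideal.span {x}) := by
    have := ringKrullDim_le_ringKrullDim_quotient_add_card ({x} : Finset R) (by
      rw [IsLocalRing.ringJacobson_eq_maximalIdeal]
      simpa using hxm)
    rw [hd, Finset.card_singleton, Finset.coe_singleton] at this
    push_cast at this
    exact (WithBot.add_le_add_iff_right' (c := ((1 : ℕ∞) : WithBot ℕ∞))
      (WithBot.coe_ne_bot) (fun h => ENat.one_ne_top (WithBot.coe_injective h))).1 this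
  have hreg : IsRegularLocalRing (R ⧸ Ideal.span {x}) :=
    .of_spanFinrank_maximalIdeal_le _ ((by exact_mod_cast hle : _ ≤ (d : WithBot ℕ∞)).trans hge)
  exact ⟨hreg, le_antisymm ((ringKrullDim_le_spanFinrank_maximalIdeal _).trans
    (by exact_mod_cast hle)) hge⟩

-- The two properties share one induction: that $R/(x)$ is a domain makes $x$ prime, which is what
-- lifts complete integral closedness to $R$.
universe u in
theorem isDomain_and_isCompletelyIntegrallyClosed_of_ringKrullDim_eq (d : ℕ) :
    ∀ (R : Type u) [CommRing R] [IsRegularLocalRing R], ringKrullDim R = d →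
      IsDomain R ∧ IsCompletelyIntegrallyClosed R := by
  induction d with
  | zero =>
    intro R _ _ hd
    have hrank : (maximalIdeal R).spanFinrank = 0 := by
      have := IsRegularLocalRing.spanFinrank_maximalIdeal (R := R)
      rw [hd] at this
      exact_mod_cast this
    rw [Submodule.spanFinrank_eq_zero_iff_eq_bot (IsNoetherian.noetherian _)] at hrank
    have hF := isField_iff_maximalIdeal_eq.2 hrank
    refine ⟨hF.isDomain, fun s b c _ hc _ => ?_⟩
    obtain ⟨e, he⟩ := hF.mul_inv_cancel hc
    exact ⟨e * b, by rw [← mul_assoc, he, one_mul]⟩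
  | succ d ih =>
    intro R _ _ hd
    obtain ⟨x, hx, hmin, hreg, hdim⟩ := exists_isRegularLocalRing_quotient hd
    obtain ⟨hdom, hcic⟩ := ih _ hdim
    have hp := (Ideal.Quotient.isDomain_iff_prime _).1 hdom
    have := isDomain_of_prime_span hx hp hmin
    have hx0 : x ≠ 0 := by
      rintro rfl
      obtain ⟨q, hq⟩ := Ideal.nonempty_minimalPrimes (I := (⊥ : Ideal R)) bot_ne_top
      exact hmin q hq q.zero_mem
    exact ⟨this, .of_quotient_prime hx ((Ideal.span_singleton_prime hx0).1 hp) hcic⟩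

theorem IsRegularLocalRing.isIntegrallyClosed (R : Type*) [CommRing R] [IsRegularLocalRing R] :
    IsIntegrallyClosed R := by
  obtain ⟨hdom, hcic⟩ := isDomain_and_isCompletelyIntegrallyClosed_of_ringKrullDim_eq _ R
    (IsRegularLocalRing.spanFinrank_maximalIdeal (R := R)).symm
  rw [isIntegrallyClosed_iff (FractionRing R)]
  intro z hz
  obtain ⟨s, hs, h⟩ := hz.isAlmostIntegral
  obtain ⟨b, c, hc, rfl⟩ := IsFractionRing.div_surjective (A := R) z
  have hc0 := nonZeroDivisors.ne_zero hc
  have hc0' : algebraMap R (FractionRing R) c ≠ 0 := by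
    simpa using hc0
  obtain ⟨e, he⟩ := hcic s b c (nonZeroDivisors.ne_zero hs) hc0 fun n => by
    obtain ⟨w, hw⟩ := h n
    refine ⟨w, IsFractionRing.injective R (FractionRing R) ?_⟩
    rw [map_mul, map_mul, hw, Algebra.smul_def, map_pow, map_pow, div_pow]
    field_simp
  refine ⟨e, ?_⟩
  rw [he, map_mul, mul_div_cancel_left₀ _ hc0']

/-! ### Zariski's Main Theorem and $R_n\ne V$ -/

/-- Over a local ring `R`, the quotient of a discrete valuation ring `S` by a power of its maximal
ideal is finite as soon as the residue field of `S` is. -/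
theorem finite_quotient_span_pow (R : Type*) {S : Type*} [CommRing R] [CommRing S] [IsLocalRing S]
    [Algebra R S] [Module.Finite R (ResidueField S)] {t : S} (ht : maximalIdeal S = Ideal.span {t})
    (e : ℕ) : Module.Finite R (S ⧸ Ideal.span {t ^ e}) := by
  have h1 : ∃ N : Submodule R S, N.FG ∧ ∀ s, ∃ n ∈ N, ∃ r, s = n + t * r := by
    obtain ⟨F, hF⟩ := (Module.Finite.fg_top : (⊤ : Submodule R (ResidueField S)).FG)
    obtain ⟨G, hG⟩ : ∃ G : Finset S, (residue S) '' G = F := by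
      classical
      refine ⟨F.image (Function.surjInv (residue_surjective (R := S))), ?_⟩
      rw [Finset.coe_image, Set.image_image]
      simp [Function.surjInv_eq]
    refine ⟨Submodule.span R G, ⟨G, rfl⟩, fun s => ?_⟩
    have hs : (IsScalarTower.toAlgHom R S (ResidueField S)).toLinearMap s ∈
        (Submodule.span R (G : Set S)).map
          (IsScalarTower.toAlgHom R S (ResidueField S)).toLinearMap := by
      rw [Submodule.map_span]
      have : ((IsScalarTower.toAlgHom R S (ResidueField S)).toLinearMap '' (G : Set S)) = F := hG
      rw [this, hF]
      trivial
    obtain ⟨n, hn, hns⟩ := hs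
    have hmem : s - n ∈ maximalIdeal S := by
      rw [← residue_eq_zero_iff, map_sub, sub_eq_zero]
      exact hns.symm
    rw [ht, Ideal.mem_span_singleton] at hmem
    obtain ⟨r, hr⟩ := hmem
    exact ⟨n, hn, r, by rw [← hr]; ring⟩
  obtain ⟨N₁, hN₁, hs₁⟩ := h1
  have key : ∃ N : Submodule R S, N.FG ∧ ∀ s, ∃ n ∈ N, ∃ r, s = n + t ^ e * r := by
    induction e with
    | zero => exact ⟨⊥, Submodule.fg_bot, fun s => ⟨0, Submodule.zero_mem _, s, by simp⟩⟩
    | succ e ih =>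
      obtain ⟨N, hN, hs⟩ := ih
      refine ⟨N ⊔ N₁.map (LinearMap.mulLeft R (t ^ e)), hN.sup (hN₁.map _), fun s => ?_⟩
      obtain ⟨n, hn, r, rfl⟩ := hs s
      obtain ⟨n', hn', r', rfl⟩ := hs₁ r
      refine ⟨n + t ^ e * n', ?_, r', by ring⟩
      exact Submodule.add_mem_sup hn (Submodule.mem_map_of_mem (f := LinearMap.mulLeft R (t ^ e)) hn')
  obtain ⟨N, hN, hs⟩ := key
  have : Module.Finite R N := Module.Finite.iff_fg.2 hN
  refine Module.Finite.of_surjective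
    ((Ideal.Quotient.mkₐ R (Ideal.span {t ^ e})).toLinearMap ∘ₗ N.subtype) fun q => ?_
  obtain ⟨s, rfl⟩ := Ideal.Quotient.mk_surjective q
  obtain ⟨n, hn, r, rfl⟩ := hs s
  refine ⟨⟨n, hn⟩, ?_⟩
  rw [map_add, Ideal.Quotient.eq_zero_iff_mem.2 (Ideal.mem_span_singleton.2 (dvd_mul_right _ r)),
    add_zero]
  rfl

/-- Write $S=A_q$ with $A$ of finite type over $R$. Finiteness of $S/\mathfrak m_RS$ makes $A$
quasi-finite at $q$, so Zariski's Main Theorem provides $r\notin q$, integral over $R$, such that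
each $x\in A$ has some $r^mx$ integral. Integral elements of $A$ come from the normal ring $R$, and
$r$ is a unit there because $R\to S$ is local. So $R\to A$ is surjective, and the denominators in
$S$ are units of $R$ for the same reason. -/
theorem algebraMap_surjective_of_finite_quotient {R S K : Type*} [CommRing R] [IsDomain R]
    [IsLocalRing R] [IsIntegrallyClosed R] [CommRing S] [IsLocalRing S] [Algebra R S]
    [IsLocalHom (algebraMap R S)] [Algebra.EssFiniteType R S] [Field K] [Algebra R K]
    [IsFractionRing R K] [Algebra S K] [IsScalarTower R S K]
    (hinj : Function.Injective (algebraMap S K))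
    [hfin : Module.Finite R (S ⧸ (maximalIdeal R).map (algebraMap R S))] :
    Function.Surjective (algebraMap R S) := by
  let A := Algebra.EssFiniteType.subalgebra R S
  let q : Ideal A := (maximalIdeal S).comap (algebraMap A S)
  have hq : q.IsPrime := inferInstanceAs ((maximalIdeal S).comap (algebraMap A S)).IsPrime
  have hM : Algebra.EssFiniteType.submonoid R S = q.primeCompl := by
    ext a
    change IsUnit (algebraMap A S a) ↔ ¬ (algebraMap A S a ∈ maximalIdeal S)
    rw [mem_maximalIdeal, mem_nonunits_iff, not_not]
  have hloc : IsLocalization.AtPrime S q := by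
    have := Algebra.EssFiniteType.isLocalization (R := R) (S := S)
    rwa [hM] at this
  have hunder : q.under R = maximalIdeal R := by
    have h1 := ((local_hom_TFAE (algebraMap R S)).out 0 4).1 ‹_›
    rw [← h1, Ideal.under_def, Ideal.comap_comap, ← IsScalarTower.algebraMap_eq]
  have hwqf : Algebra.WeaklyQuasiFiniteAt R q := by
    rw [Algebra.weaklyQuasiFiniteAt_iff, hunder]
    let ε : S ≃ₐ[R] Localization.AtPrime q :=
      (IsLocalization.algEquiv q.primeCompl S (Localization.AtPrime q)).restrictScalars R
    have hmap : (maximalIdeal R).map (algebraMap R (Localization.AtPrime q)) =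
        ((maximalIdeal R).map (algebraMap R S)).map (ε : S →+* Localization.AtPrime q) := by
      rw [Ideal.map_map]
      congr 1
      ext r
      exact (ε.commutes r).symm
    exact (Algebra.QuasiFinite.iff_of_algEquiv (Ideal.quotientEquivAlg _ _ ε hmap)).1 inferInstance
  obtain ⟨r, hrq, hr, hx⟩ := Algebra.zariskisMainProperty_iff.1
    (Algebra.ZariskisMainProperty.of_finiteType_of_weaklyQuasiFiniteAt (R := R) q)
  have hAK : Function.Injective (algebraMap A K) := by
    rw [IsScalarTower.algebraMap_eq A S K]
    exact hinj.comp Subtype.val_injective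
  have hint : ∀ a : A, IsIntegral R a → ∃ y, algebraMap R A y = a := by
    intro a ha
    obtain ⟨y, hy⟩ := IsIntegrallyClosed.isIntegral_iff.1 (ha.algebraMap (B := K))
    refine ⟨y, hAK ?_⟩
    rw [← hy, ← IsScalarTower.algebraMap_apply]
  have hunit : ∀ y : R, IsUnit (algebraMap R S y) → IsUnit y :=
    fun y hy => IsLocalHom.map_nonunit y hy
  obtain ⟨r₀, rfl⟩ := hint r hr
  have hr₀ : IsUnit r₀ := by
    refine hunit _ ?_
    have : ¬ (algebraMap A S (algebraMap R A r₀) ∈ maximalIdeal S) := hrq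
    rwa [mem_maximalIdeal, mem_nonunits_iff, not_not, ← IsScalarTower.algebraMap_apply] at this
  have hA : Function.Surjective (algebraMap R A) := by
    intro x
    obtain ⟨m, hm⟩ := hx x
    obtain ⟨y, hy⟩ := hint _ hm
    obtain ⟨u, hu⟩ := (hr₀.pow m).exists_left_inv
    refine ⟨u * y, ?_⟩
    rw [map_mul, hy, ← mul_assoc, ← map_pow, ← map_mul, hu, map_one, one_mul]
  intro s
  obtain ⟨⟨a, m⟩, hs⟩ := IsLocalization.surj q.primeCompl s
  obtain ⟨a₀, ha₀⟩ := hA a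
  obtain ⟨m₀, hm₀⟩ := hA m
  have hmu : IsUnit (algebraMap R S m₀) := by
    rw [IsScalarTower.algebraMap_apply R A S, hm₀]
    exact IsLocalization.map_units S m
  obtain ⟨u, hu⟩ := (hunit _ hmu).exists_right_inv
  refine ⟨a₀ * u, ?_⟩
  dsimp only at hs
  rw [← ha₀, ← hm₀, ← IsScalarTower.algebraMap_apply, ← IsScalarTower.algebraMap_apply] at hs
  rw [map_mul, ← hs, mul_assoc, ← map_mul, hu, map_one, mul_one]

theorem finiteType_inclusion_of_eq_adjoin {R B : Subring K} (h : R ≤ B) (t : Finset K)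
    (hB : B = (Algebra.adjoin R (t : Set K)).toSubring) : (Subring.inclusion h).FiniteType := by
  subst hB
  exact (Subalgebra.fg_iff_finiteType _).1 ⟨t, rfl⟩

theorem blowupChart_eq_adjoin (R : LocalSubring K) [IsNoetherianRing R.toSubring] (a : K) :
    ∃ t : Finset K, blowupChart R a = (Algebra.adjoin R.toSubring (t : Set K)).toSubring := by
  classical
  obtain ⟨s, hs⟩ := (maximalIdeal R.toSubring).fg_of_isNoetherianRing
  refine ⟨s.image fun b : R.toSubring => (b : K) / a, le_antisymm ?_ ?_⟩
  · rw [blowupChart, Subring.closure_le]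
    rintro _ (hx | ⟨⟨b, hb⟩, rfl⟩)
    · exact (Algebra.adjoin R.toSubring _).algebraMap_mem ⟨_, hx⟩
    · have hb' : b ∈ Ideal.span (s : Set R.toSubring) := hs.ge hb
      change (b : K) / a ∈ Algebra.adjoin R.toSubring _
      clear hb
      induction hb' using Submodule.span_induction with
      | mem x hx => exact Algebra.subset_adjoin (Finset.mem_image_of_mem _ hx)
      | zero => simp
      | add x y _ _ hx hy =>
        rw [Subring.coe_add, add_div]
        exact add_mem hx hy
      | smul r x _ hx =>
        rw [smul_eq_mul, Subring.coe_mul, mul_div_assoc]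
        exact mul_mem ((Algebra.adjoin R.toSubring _).algebraMap_mem r) hx
  · intro x hx
    change x ∈ Algebra.adjoin R.toSubring _ at hx
    induction hx using Algebra.adjoin_induction with
    | mem x hx =>
      obtain ⟨b, hb, rfl⟩ := Finset.mem_image.1 hx
      exact div_mem_blowupChart a (hs.le (Ideal.subset_span hb))
    | algebraMap r => exact le_blowupChart R a r.2
    | add x y _ _ hx hy => exact add_mem hx hy
    | mul x y _ _ hx hy => exact mul_mem hx hy

theorem isNoetherianRing_of_essFiniteType_inclusion {R B : Subring K} {h : R ≤ B}
    (hf : (Subring.inclusion h).EssFiniteType) [IsNoetherianRing R] : IsNoetherianRing B := by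
  let _ := (Subring.inclusion h).toAlgebra
  have : Algebra.EssFiniteType R B := hf
  exact Algebra.EssFiniteType.isNoetherianRing R B

theorem IsQuadraticTransformAlong.essFiniteType_inclusion {V : ValuationSubring K}
    {R R' : LocalSubring K} [IsNoetherianRing R.toSubring] (h : IsQuadraticTransformAlong V R R')
    (hle : R.toSubring ≤ R'.toSubring) : (Subring.inclusion hle).EssFiniteType := by
  obtain ⟨a, -, hV, rfl⟩ := h
  obtain ⟨t, ht⟩ := blowupChart_eq_adjoin R ((a : R.toSubring) : K)
  have h1 := (finiteType_inclusion_of_eq_adjoin (le_blowupChart R _) t ht).essFiniteType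
  have h2 : (Subring.inclusion (LocalSubring.le_ofPrime (blowupChart R ((a : R.toSubring) : K))
      (center _ V hV))).EssFiniteType :=
    Algebra.EssFiniteType.of_isLocalization _ (center _ V hV).primeCompl
  exact h1.comp h2

theorem IsQuadraticSequenceAlong.essFiniteType_inclusion (h : IsQuadraticSequenceAlong v R)
    (n : ℕ) : (Subring.inclusion (h.mono n.zero_le)).EssFiniteType := by
  have := h.regular
  induction n with
  | zero => exact (RingHom.FiniteType.of_surjective _ fun x => ⟨x, rfl⟩).essFiniteType
  | succ n ih =>
    have := isNoetherianRing_of_essFiniteType_inclusion ih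
    exact ih.comp ((h.transform n).essFiniteType_inclusion (h.mono n.le_succ))

/-- The quadratic transforms along a zero-dimensional valuation never become the valuation ring. -/
theorem IsQuadraticSequenceAlong.ne_valuationRing (h : IsQuadraticSequenceAlong v R) (n : ℕ) :
    R n ≠ (valuationRing v).toLocalSubring := by
  intro heq
  have hreg := h.regular
  have hic := IsRegularLocalRing.isIntegrallyClosed (R 0).toSubring
  have hfrac := h.isFractionRing
  obtain ⟨hle, hlocal, halg⟩ := h.zeroDimensional
  -- Under `heq`, $V$ is essentially of finite type over $R_0$, hence a Noetherian valuation ring,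
  -- hence a DVR. Its residue field is algebraic and essentially of finite type over that of $R_0$,
  -- so finite. Therefore $V/\mathfrak m_0V=V/(ϖ^e)$ is finite over $R_0$ and $R_0=V$ has dimension
  -- one.
  have hess : (Subring.inclusion hle).EssFiniteType := by
    have key : ∀ B : LocalSubring K, R n = B → ∀ hB : (R 0).toSubring ≤ B.toSubring,
        (Subring.inclusion hB).EssFiniteType := by
      rintro _ rfl hB
      exact h.essFiniteType_inclusion n
    exact key _ heq hle
  have hnoeth := isNoetherianRing_of_essFiniteType_inclusion hess
  have hval : ValuationRing (valuationRing v).toLocalSubring.toSubring :=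
    inferInstanceAs (ValuationRing (valuationRing v))
  have hpid : IsPrincipalIdealRing (valuationRing v).toLocalSubring.toSubring :=
    ((IsBezout.TFAE (R := (valuationRing v).toLocalSubring.toSubring)).out 0 1).1 hnoeth
  let _ := (Subring.inclusion hle).toAlgebra
  have : IsLocalHom (algebraMap (R 0).toSubring (valuationRing v).toLocalSubring.toSubring) := hlocal
  have : Algebra.EssFiniteType (R 0).toSubring (valuationRing v).toLocalSubring.toSubring := hess
  have hresfin : (ResidueField.map (Subring.inclusion hle)).Finite :=
    @Algebra.finite_of_essFiniteType_of_isAlgebraic _ _ _ _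
      (ResidueField.map (Subring.inclusion hle)).toAlgebra hess.residueFieldMap halg
  have : Module.Finite (R 0).toSubring
      (ResidueField (valuationRing v).toLocalSubring.toSubring) := by
    have := hresfin.comp (RingHom.Finite.of_surjective _ (residue_surjective (R := (R 0).toSubring)))
    rwa [ResidueField.map_comp_residue] at this
  have : IsScalarTower (R 0).toSubring (valuationRing v).toLocalSubring.toSubring K :=
    .of_algebraMap_eq fun _ => rfl
  obtain ⟨a, μ, hμ, hμ0, ha, -, -⟩ := h.exists_generators
  have hane : a 0 ≠ 0 := by
    intro h0
    have := hμ 0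
    simp [h0] at this
  have ham : (⟨a 0, ha 0⟩ : (R 0).toSubring) ∈ maximalIdeal _ := by
    rw [mem_maximalIdeal_iff (h.le_valuationRing 0), hμ]
    exact_mod_cast hμ0 0
  have hVne : maximalIdeal (valuationRing v).toLocalSubring.toSubring ≠ ⊥ := by
    intro h0
    have hpos : 0 < v (a 0) := by rw [hμ]; exact_mod_cast hμ0 0
    have hm : (⟨a 0, hle (ha 0)⟩ : (valuationRing v).toLocalSubring.toSubring) ∈ maximalIdeal _ :=
      mem_maximalIdeal_valuationRing.2 hpos
    rw [h0, Submodule.mem_bot] at hm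
    exact hane (congrArg Subtype.val hm)
  have hdvr : IsDiscreteValuationRing (valuationRing v).toLocalSubring.toSubring :=
    { not_a_field' := hVne }
  obtain ⟨ϖ, hϖ⟩ := IsDiscreteValuationRing.exists_irreducible
    (valuationRing v).toLocalSubring.toSubring
  have hbot : (maximalIdeal (R 0).toSubring).map (algebraMap (R 0).toSubring
      (valuationRing v).toLocalSubring.toSubring) ≠ ⊥ := by
    intro h0
    have := Ideal.mem_map_of_mem (algebraMap (R 0).toSubring
      (valuationRing v).toLocalSubring.toSubring) ham
    rw [h0, Submodule.mem_bot] at this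
    exact hane (congrArg Subtype.val this)
  obtain ⟨e, he⟩ := IsDiscreteValuationRing.ideal_eq_span_pow_irreducible hbot hϖ
  have hfin : Module.Finite (R 0).toSubring ((valuationRing v).toLocalSubring.toSubring ⧸
      (maximalIdeal (R 0).toSubring).map (algebraMap (R 0).toSubring
        (valuationRing v).toLocalSubring.toSubring)) := by
    rw [he]
    exact finite_quotient_span_pow (R 0).toSubring hϖ.maximalIdeal_eq e
  have hsurj := algebraMap_surjective_of_finite_quotient (R := (R 0).toSubring) (K := K)
    (S := (valuationRing v).toLocalSubring.toSubring) Subtype.val_injective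
  have h2 := h.two_le_dim
  rw [ringKrullDim_eq_of_ringEquiv (RingEquiv.ofBijective (algebraMap (R 0).toSubring
    (valuationRing v).toLocalSubring.toSubring) ⟨Subring.inclusion_injective hle, hsurj⟩),
    IsPrincipalIdealRing.ringKrullDim_eq_one _
      (IsDiscreteValuationRing.not_isField (valuationRing v).toLocalSubring.toSubring)] at h2
  have h21 : (2 : ℕ) ≤ 1 := by exact_mod_cast h2
  omega

/-! ### Maximality of $V$ and strong switching -/

theorem exists_nat_nsmul_le {a b : ℝ} (ha : 0 < a) : ∃ n : ℕ, b ≤ n * a := by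
  obtain ⟨n, hn⟩ := exists_nat_ge (b / a)
  exact ⟨n, (div_le_iff₀ ha).1 hn⟩

/-- The valuation ring of a real valuation is a maximal proper subring of its fraction field. -/
theorem eq_top_of_valuationRing_lt {W : Subring K}
    (hle : (valuationRing v).toLocalSubring.toSubring ≤ W) {z : K} (hz : z ∈ W) (hv : v z < 0) :
    W = ⊤ := by
  rw [eq_top_iff]
  intro y _
  by_cases hy : y = 0
  · exact hy ▸ zero_mem W
  have hz0 : z ≠ 0 := by rintro rfl; simp at hv
  obtain ⟨β, hβ⟩ := exists_real_eq (v := v) hy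
  obtain ⟨ζ, hζ⟩ := exists_real_eq (v := v) hz0
  have hζ0 : 0 < -ζ := by
    rw [hζ] at hv
    have : ζ < 0 := by exact_mod_cast hv
    linarith
  obtain ⟨n, hn⟩ := exists_nat_nsmul_le (b := -β) hζ0
  have hzn : v (z ^ n) = ((n * ζ : ℝ) : WithTop ℝ) := by
    rw [AddValuation.map_pow, hζ, ← WithTop.coe_nsmul, nsmul_eq_mul]
  have hmem : y / z ^ n ∈ (valuationRing v).toLocalSubring.toSubring := by
    rw [mem_toSubring_iff, map_div_eq hβ hzn]
    have : 0 ≤ β - n * ζ := by linarith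
    exact_mod_cast this
  rw [← div_mul_cancel₀ y (pow_ne_zero n hz0)]
  exact mul_mem (hle hmem) (pow_mem hz n)

theorem switchesStronglyInfinitelyOften_of_valueSum_eq_top (h : IsQuadraticSequenceAlong v R)
    (hs : valueSum v R = ⊤) : SwitchesStronglyInfinitelyOften R := by
  rintro ⟨j, p, hp, hheight, hsub⟩
  rw [iUnion_eq_of_valueSum_eq_top h hs] at hsub
  have hVW : (valuationRing v).toLocalSubring.toSubring ≤
    (LocalSubring.ofPrime (R j).toSubring p).toSubring := hsub
  have hRV := h.le_valuationRing j
  by_cases hW : ∃ z ∈ (LocalSubring.ofPrime (R j).toSubring p).toSubring, v z < 0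
  · obtain ⟨z, hz, hv⟩ := hW
    have htop := eq_top_of_valuationRing_lt hVW hz hv
    have hpbot : p = ⊥ := by
      rw [eq_bot_iff]
      intro c hc
      by_contra hc0
      rw [Submodule.mem_bot] at hc0
      have hc0' : (c : K) ≠ 0 := fun h0 => hc0 (Subtype.ext h0)
      have hmem : (c : K)⁻¹ ∈ (LocalSubring.ofPrime (R j).toSubring p).toSubring :=
        htop ▸ Subring.mem_top _
      obtain ⟨a, s, hsp, hcas⟩ := mem_ofPrime_iff.1 hmem
      refine hsp ?_
      have hs0 : (s : K) ≠ 0 := by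
        intro h0
        have : s = 0 := Subtype.ext h0
        exact hsp (this ▸ p.zero_mem)
      have : s = a * c := Subtype.ext (by
        rw [Subring.coe_mul]
        field_simp at hcas
        rw [hcas, mul_comm])
      rw [this]
      exact p.mul_mem_left a hc
    rw [hpbot, Ideal.height_bot] at hheight
    exact zero_ne_one hheight
  -- Now $(R_j)_{\mathfrak p}\subseteq V$, so elements outside $\mathfrak p$ have inverses in $V$
  -- and value zero. They are therefore already units of $R_j$, and $V=(R_j)_{\mathfrak p}=R_j$.
  · push Not at hW
    refine h.ne_valuationRing j (LocalSubring.toSubring_injective (le_antisymm hRV.1 fun z hz => ?_))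
    obtain ⟨a, s, hsp, rfl⟩ := mem_ofPrime_iff.1 (hVW hz)
    have hs0 : (s : K) ≠ 0 := fun h0 => hsp ((Subtype.ext h0 : s = 0) ▸ p.zero_mem)
    have hsinv : 0 ≤ v (s : K)⁻¹ :=
      hW _ (mem_ofPrime_iff.2 ⟨1, s, hsp, by rw [Subring.coe_one, one_div]⟩)
    have hvs : v (s : K) = 0 := by
      refine le_antisymm ?_ (nonneg_of_mem hRV s.2)
      rw [← map_inv_add (v := v) hs0]
      exact le_add_of_nonneg_right hsinv
    rw [div_eq_mul_inv]
    exact mul_mem a.2 (inv_mem_of_map_eq_zero hRV s.2 hvs)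

/-! ### Quadratic transforms of localizations of $k[u,w]$ -/

theorem ofPrime_center_congr {V : ValuationSubring K} {A B : Subring K} (hAB : A = B)
    (hA : A ≤ V.toLocalSubring.toSubring) (hB : B ≤ V.toLocalSubring.toSubring) :
    LocalSubring.ofPrime A (center A V hA) = LocalSubring.ofPrime B (center B V hB) := by
  subst hAB
  rfl

section TwoGenerators

variable (k : Type*) [Field k] [Algebra k K]

/-- The subring `k[u, w]` of `K`. -/
def coordRing (u w : K) : Subring K := (Algebra.adjoin k {u, w}).toSubring

variable {k}

theorem left_mem_coordRing (u w : K) : u ∈ coordRing k u w :=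
  Algebra.subset_adjoin (R := k) (Set.mem_insert u {w})

theorem right_mem_coordRing (u w : K) : w ∈ coordRing k u w :=
  Algebra.subset_adjoin (R := k) (Set.mem_insert_of_mem u rfl)

theorem algebraMap_mem_coordRing (u w : K) (c : k) : algebraMap k K c ∈ coordRing k u w :=
  (Algebra.adjoin k {u, w}).algebraMap_mem c

theorem coordRing_comm (u w : K) : coordRing k u w = coordRing k w u := by
  rw [coordRing, coordRing, Set.pair_comm]

theorem coordRing_le {u w : K} {A : Subring K} (hk : ∀ c, algebraMap k K c ∈ A) (hu : u ∈ A)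
    (hw : w ∈ A) : coordRing k u w ≤ A := by
  intro x hx
  change x ∈ Algebra.adjoin k {u, w} at hx
  induction hx using Algebra.adjoin_induction with
  | mem x hx => rcases hx with rfl | rfl <;> assumption
  | algebraMap r => exact hk r
  | add x y _ _ hx hy => exact add_mem hx hy
  | mul x y _ _ hx hy => exact mul_mem hx hy

theorem exists_eq_of_mem_coordRing {u w x : K} (hx : x ∈ coordRing k u w) :
    ∃ c, ∃ a ∈ coordRing k u w, ∃ b ∈ coordRing k u w, x = algebraMap k K c + u * a + w * b := by
  change x ∈ Algebra.adjoin k {u, w} at hx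
  induction hx using Algebra.adjoin_induction with
  | mem x hx =>
    rcases hx with rfl | rfl
    · exact ⟨0, 1, one_mem _, 0, zero_mem _, by simp⟩
    · exact ⟨0, 0, zero_mem _, 1, one_mem _, by simp⟩
  | algebraMap r => exact ⟨r, 0, zero_mem _, 0, zero_mem _, by simp⟩
  | add x y _ _ hx hy =>
    obtain ⟨c, a, ha, b, hb, rfl⟩ := hx
    obtain ⟨c', a', ha', b', hb', rfl⟩ := hy
    exact ⟨c + c', _, add_mem ha ha', _, add_mem hb hb', by rw [map_add]; ring⟩
  | mul x y _ hy' hx hy =>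
    obtain ⟨c, a, ha, b, hb, rfl⟩ := hx
    obtain ⟨c', a', ha', b', hb', hy⟩ := hy
    have hc := algebraMap_mem_coordRing u w c
    refine ⟨c * c', _, add_mem (mul_mem ha hy') (mul_mem hc ha'), _,
      add_mem (mul_mem hb hy') (mul_mem hc hb'), ?_⟩
    rw [map_mul, add_mul, add_mul, hy]
    ring

variable (hk : ∀ c : k, c ≠ 0 → v (algebraMap k K c) = 0)
include hk

theorem nonneg_algebraMap (c : k) : 0 ≤ v (algebraMap k K c) := by
  by_cases hc : c = 0
  · simp [hc]
  · exact (hk c hc).ge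

theorem coordRing_le_valuationRing {u w : K} (hu : 0 ≤ v u) (hw : 0 ≤ v w) :
    coordRing k u w ≤ (valuationRing v).toLocalSubring.toSubring :=
  coordRing_le (nonneg_algebraMap hk) hu hw

/-- Nonzero constants have value zero, so positive value kills the constant term. In the
localization at the center, $u$ and $w$ thus generate the maximal ideal. -/
theorem exists_eq_of_mem_coordRing_of_pos {u w x : K} (hu : 0 < v u) (hw : 0 < v w)
    (hx : x ∈ coordRing k u w) (hv : 0 < v x) :
    ∃ a ∈ coordRing k u w, ∃ b ∈ coordRing k u w, x = u * a + w * b := by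
  obtain ⟨c, a, ha, b, hb, rfl⟩ := exists_eq_of_mem_coordRing hx
  have hle := coordRing_le_valuationRing hk hu.le hw.le
  by_cases hc : c = 0
  · exact ⟨a, ha, b, hb, by simp [hc]⟩
  · exfalso
    have h1 : 0 < v (u * a + w * b) := by
      refine AddValuation.map_lt_add _ ?_ ?_ <;> rw [AddValuation.map_mul]
      · exact add_pos_of_pos_of_nonneg hu (hle ha)
      · exact add_pos_of_pos_of_nonneg hw (hle hb)
    have h2 := AddValuation.map_lt_add v hv (h1.trans_eq (AddValuation.map_neg v _).symm)
    have e : algebraMap k K c + u * a + w * b + -(u * a + w * b) = algebraMap k K c := by ring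
    rw [e, hk c hc] at h2
    exact lt_irrefl _ h2

/-- One quadratic transform of the localization of `k[u, w]` at the center of `v`. -/
theorem isQuadraticTransformAlong_ofPrime {u w : K} (hu0 : u ≠ 0) (hu : 0 < v u) (hw : 0 < v w)
    (c : k)
    (h : coordRing k u w ≤ (valuationRing v).toLocalSubring.toSubring)
    (h' : coordRing k u (w / u - algebraMap k K c) ≤
      (valuationRing v).toLocalSubring.toSubring) :
    IsQuadraticTransformAlong (valuationRing v)
      (LocalSubring.ofPrime (coordRing k u w) (center _ (valuationRing v) h))
      (LocalSubring.ofPrime (coordRing k u (w / u - algebraMap k K c))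
        (center _ (valuationRing v) h')) := by
  set w' := w / u - algebraMap k K c with hw'def
  set R := LocalSubring.ofPrime (coordRing k u w) (center _ (valuationRing v) h) with hR
  set R' := LocalSubring.ofPrime (coordRing k u w') (center _ (valuationRing v) h') with hR'
  have hRV : R ≤ (valuationRing v).toLocalSubring := ofPrime_center_le h
  have hR'V : R' ≤ (valuationRing v).toLocalSubring := ofPrime_center_le h'
  have hAR : coordRing k u w ≤ R.toSubring := LocalSubring.le_ofPrime _ _
  have hAR' : coordRing k u w' ≤ R'.toSubring := LocalSubring.le_ofPrime _ _
  have huR' : u ∈ R'.toSubring := hAR' (left_mem_coordRing u w')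
  have hkR' : ∀ c, algebraMap k K c ∈ R'.toSubring := fun c => hAR' (algebraMap_mem_coordRing u w' c)
  have hwu : w / u ∈ R'.toSubring := by
    have : w / u = w' + algebraMap k K c := by rw [hw'def]; ring
    rw [this]
    exact add_mem (hAR' (right_mem_coordRing u w')) (hkR' c)
  have hw_eq : w = w / u * u := by rw [div_mul_cancel₀ _ hu0]
  have hAA' : coordRing k u w ≤ R'.toSubring :=
    coordRing_le hkR' huR' (by rw [hw_eq]; exact mul_mem hwu huR')
  have hRR' : R.toSubring ≤ R'.toSubring := by
    intro z hz
    obtain ⟨a, ha, s, hs, h0, rfl⟩ := mem_ofPrime_center_iff.1 hz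
    rw [div_eq_mul_inv]
    exact mul_mem (hAA' ha) (inv_mem_of_map_eq_zero hR'V (hAA' hs) h0)
  have huR : u ∈ R.toSubring := hAR (left_mem_coordRing u w)
  have hwR : w ∈ R.toSubring := hAR (right_mem_coordRing u w)
  -- On both sides all elements of value zero get inverted, so it is enough to compare generators.
  -- Elements of $\mathfrak m$ are $(ua_1+wa_2)/s$ with $v(s)=0$, which puts the chart inside `R'`;
  -- conversely $w'=w/u-c$ lies in the chart.
  have hB : blowupChart R u ≤ R'.toSubring := by
    rw [blowupChart, Subring.closure_le]
    rintro _ (hx | ⟨⟨b, hb⟩, rfl⟩)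
    · exact hRR' hx
    · obtain ⟨a, ha, s, hs, h0, hbas⟩ := mem_ofPrime_center_iff.1 b.2
      have hs0 : s ≠ 0 := by rintro rfl; simp at h0
      have hva : 0 < v a := by
        have : a = b * s := by rw [hbas, div_mul_cancel₀ _ hs0]
        rw [this, AddValuation.map_mul, h0, add_zero]
        exact (mem_maximalIdeal_iff hRV).1 hb
      obtain ⟨a₁, ha₁, a₂, ha₂, rfl⟩ := exists_eq_of_mem_coordRing_of_pos hk hu hw ha hva
      change (b : K) / u ∈ R'.toSubring
      have : (b : K) / u = (a₁ + w / u * a₂) * s⁻¹ := by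
        rw [hbas]
        field_simp
      rw [this]
      exact mul_mem (add_mem (hAA' ha₁) (mul_mem hwu (hAA' ha₂)))
        (inv_mem_of_map_eq_zero hR'V (hAA' hs) h0)
  have hBV : blowupChart R u ≤ (valuationRing v).toLocalSubring.toSubring := hB.trans hR'V.1
  have hum : (⟨u, huR⟩ : R.toSubring) ∈ maximalIdeal R.toSubring :=
    (mem_maximalIdeal_iff hRV).2 hu
  refine ⟨⟨⟨u, huR⟩, hum⟩, hu0, hBV, LocalSubring.toSubring_injective (le_antisymm ?_ ?_)⟩
  · have hA'B : coordRing k u w' ≤ blowupChart R u := by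
      have hkB : ∀ c, algebraMap k K c ∈ blowupChart R u := fun c =>
        le_blowupChart R u (hAR (algebraMap_mem_coordRing u w c))
      exact coordRing_le hkB (le_blowupChart R u huR) (sub_mem (div_mem_blowupChart u (b := ⟨w, hwR⟩)
        ((mem_maximalIdeal_iff hRV).2 hw)) (hkB c))
    intro z hz
    obtain ⟨a, ha, s, hs, h0, rfl⟩ := mem_ofPrime_center_iff.1 hz
    exact mem_ofPrime_center_iff.2 ⟨a, hA'B ha, s, hA'B hs, h0, rfl⟩
  · intro z hz
    obtain ⟨a, ha, s, hs, h0, rfl⟩ := mem_ofPrime_center_iff.1 hz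
    rw [div_eq_mul_inv]
    exact mul_mem (hB ha) (inv_mem_of_map_eq_zero hR'V (hB hs) h0)

theorem maximalIdealValue_ofPrime {u w : K} {μ : ℝ} (hμ : v u = μ) (hu : 0 < v u)
    (hw : v u ≤ v w) (h : coordRing k u w ≤ (valuationRing v).toLocalSubring.toSubring) :
    maximalIdealValue v (LocalSubring.ofPrime (coordRing k u w) (center _ (valuationRing v) h)) =
      ENNReal.ofReal μ := by
  have hRV := ofPrime_center_le h
  have huR := LocalSubring.le_ofPrime (coordRing k u w) (center _ (valuationRing v) h)
    (left_mem_coordRing u w)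
  refine le_antisymm ((iInf_le _ ⟨⟨u, huR⟩, (mem_maximalIdeal_iff hRV).2 hu⟩).trans
    (by rw [hμ]; rfl)) (le_iInf fun x => ?_)
  obtain ⟨a, ha, s, hs, h0, hx⟩ := mem_ofPrime_center_iff.1 x.1.2
  have hs0 : s ≠ 0 := by rintro rfl; simp at h0
  have hva : v a = v (x.1 : K) := by
    have : a = x.1 * s := by rw [hx, div_mul_cancel₀ _ hs0]
    rw [this, AddValuation.map_mul, h0, add_zero]
  have hxpos := (mem_maximalIdeal_iff hRV).1 x.2
  obtain ⟨a₁, ha₁, a₂, ha₂, rfl⟩ := exists_eq_of_mem_coordRing_of_pos hk hu (hu.trans_le hw) ha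
    (hva ▸ hxpos)
  have hle : v u ≤ v (x.1 : K) := by
    rw [← hva]
    refine AddValuation.map_le_add v ?_ ?_ <;> rw [AddValuation.map_mul]
    · exact le_add_of_nonneg_right (h ha₁)
    · exact hw.trans (le_add_of_nonneg_right (h ha₂))
  rw [hμ] at hle
  cases hvx : v (x.1 : K) with
  | top => exact le_top
  | coe r =>
    rw [hvx] at hle
    exact ENNReal.ofReal_le_ofReal (by exact_mod_cast hle)

omit hk in
theorem isZeroDimensionalOver_of_forall_exists {R : LocalSubring K}
    (hR : R ≤ (valuationRing v).toLocalSubring)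
    (h : ∀ z : K, 0 ≤ v z → ∃ r ∈ R.toSubring, 0 < v (z - r)) :
    IsZeroDimensionalOver (valuationRing v) R := by
  obtain ⟨hle, hlocal⟩ := hR
  refine ⟨hle, hlocal, ?_⟩
  let _ := (ResidueField.map (Subring.inclusion hle)).toAlgebra
  refine ⟨fun z => ?_⟩
  obtain ⟨z, rfl⟩ := residue_surjective z
  obtain ⟨r, hr, hv⟩ := h z z.2
  have h1 : residue _ z = algebraMap (ResidueField R.toSubring)
      (ResidueField (valuationRing v).toLocalSubring.toSubring) (residue _ ⟨r, hr⟩) := by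
    change _ = residue _ (Subring.inclusion hle ⟨r, hr⟩)
    rw [← sub_eq_zero, ← map_sub, residue_eq_zero_iff]
    exact mem_maximalIdeal_valuationRing.2 hv
  rw [h1]
  exact isAlgebraic_algebraMap _

end TwoGenerators

/-! ### Regularity of the plane at the origin -/

section Regular

open Polynomial

variable {k : Type*} [Field k]

/-- The chain is $0\subsetneq(y)\subsetneq P$ with $y$ the inner variable. -/
theorem two_le_height_of_mem {P : Ideal k[X][X]} [P.IsPrime] (hX : X ∈ P) (hC : C X ∈ P) :
    2 ≤ P.height := by
  have hprime : (Ideal.span {(C X : k[X][X])}).IsPrime :=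
    (Ideal.span_singleton_prime (by simp)).2 (prime_C_iff.2 prime_X)
  have h1 : (⊥ : Ideal k[X][X]) < Ideal.span {(C X : k[X][X])} := by
    rw [bot_lt_iff_ne_bot, Ne, Ideal.span_singleton_eq_bot]
    simp
  have h2 : Ideal.span {(C X : k[X][X])} < P := by
    refine lt_of_le_of_ne ((Ideal.span_singleton_le_iff_mem P).2 hC) fun h => ?_
    rw [← h, Ideal.mem_span_singleton] at hX
    obtain ⟨g, hg⟩ := hX
    have := congrArg (fun f => Polynomial.coeff f 1) hg
    simp only [coeff_X_one, coeff_C_mul] at this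
    exact not_isUnit_X (IsUnit.of_mul_eq_one _ this.symm)
  have h3 := Ideal.height_add_one_le_of_lt_of_isPrime h1
  have h4 := Ideal.height_add_one_le_of_lt_of_isPrime h2
  calc (2 : ℕ∞) = 0 + 1 + 1 := by norm_num
    _ ≤ (⊥ : Ideal k[X][X]).height + 1 + 1 := by gcongr; exact zero_le
    _ ≤ _ := (add_le_add_left h3 1).trans h4

theorem isRegularLocalRing_ofPrime {A : Subring K} (e : k[X][X] ≃+* A) (P : Ideal A) [P.IsPrime]
    (hX : e X ∈ P) (hC : e (C X) ∈ P) :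
    IsRegularLocalRing (LocalSubring.ofPrime A P).toSubring ∧
      2 ≤ ringKrullDim (LocalSubring.ofPrime A P).toSubring := by
  have hA : IsRegularRing A := IsRegularRing.of_ringEquiv e
  have hreg : IsRegularLocalRing (Localization.AtPrime P) := inferInstance
  refine ⟨IsRegularLocalRing.of_ringEquiv (LocalSubring.ofPrimeEquiv A P).toRingEquiv, ?_⟩
  rw [IsLocalization.AtPrime.ringKrullDim_eq_height P (LocalSubring.ofPrime A P).toSubring]
  have hprime : (P.comap (e : k[X][X] →+* A)).IsPrime := inferInstance
  have h1 := two_le_height_of_mem (P := P.comap (e : k[X][X] →+* A)) hX hC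
  have h2 : (P.comap (e : k[X][X] →+* A)).height = P.height := RingEquiv.height_comap e P
  rw [h2] at h1
  exact WithBot.coe_le_coe.2 h1

end Regular

open Polynomial

/-! ### The substitution and the drop of the order -/

section Toric

variable {k : Type*} [Field k]

/-- The monomial substitution `x ↦ s² u`, `y ↦ s ^ (2 m + 1) u ^ m`, where `x` and `s` are the
outer variables, `y` and `u` the inner ones. -/
noncomputable def toric (k : Type*) [Field k] (m : ℕ) : k[X][X] →+* k[X][X] :=
  eval₂RingHom (eval₂RingHom (C.comp C) (X ^ (2 * m + 1) * C (X ^ m))) (X ^ 2 * C X)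

theorem toric_monomial (m a b : ℕ) (c : k) :
    toric k m (monomial a (monomial b c)) =
      monomial (2 * a + (2 * m + 1) * b) (monomial (a + m * b) c) := by
  rw [toric, coe_eval₂RingHom, eval₂_monomial, coe_eval₂RingHom, eval₂_monomial]
  simp only [← C_mul_X_pow_eq_monomial, RingHom.comp_apply, C_mul, C_pow]
  ring

/-- On exponents the substitution is $(a,b)\mapsto(n,e)=(2a+(2m+1)b,\,a+mb)$, of determinant $-1$,
with inverse $b=n-2e$, $a=e-m(n-2e)$. The guard says that these truncated subtractions are exact. -/
theorem coeff_toric (m : ℕ) (f : k[X][X]) (n e : ℕ) :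
    ((toric k m f).coeff n).coeff e =
      if 2 * e ≤ n ∧ m * (n - 2 * e) ≤ e then
        (f.coeff (e - m * (n - 2 * e))).coeff (n - 2 * e) else 0 := by
  induction f using Polynomial.induction_on' with
  | add f g hf hg =>
    rw [map_add, coeff_add, coeff_add, hf, hg]
    split_ifs <;> simp
  | monomial a p =>
    induction p using Polynomial.induction_on' with
    | add p q hp hq =>
      rw [map_add, map_add, coeff_add, coeff_add, hp, hq, coeff_add]
      split_ifs <;> simp
    | monomial b c =>
      rw [toric_monomial]
      simp only [coeff_monomial]
      have hiff : (2 * a + (2 * m + 1) * b = n ∧ a + m * b = e) ↔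
          ((2 * e ≤ n ∧ m * (n - 2 * e) ≤ e) ∧ a = e - m * (n - 2 * e) ∧ b = n - 2 * e) := by
        constructor
        · rintro ⟨rfl, rfl⟩
          have h1 : (2 * m + 1) * b = 2 * (m * b) + b := by ring
          have h2 : 2 * a + (2 * m + 1) * b - 2 * (a + m * b) = b := by omega
          rw [h2]
          omega
        · rintro ⟨⟨h1, h2⟩, h3, h4⟩
          have h5 : (2 * m + 1) * b = 2 * (m * (n - 2 * e)) + (n - 2 * e) := by rw [h4]; ring
          rw [h5, h4]
          omega
      by_cases h : 2 * a + (2 * m + 1) * b = n ∧ a + m * b = e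
      · obtain ⟨h1, h2, h3⟩ := hiff.1 h
        rw [if_pos h.1, if_pos h1, if_pos h2, coeff_monomial, coeff_monomial, if_pos h.2, if_pos h3]
      · have h' := mt hiff.2 h
        have hl : (if 2 * a + (2 * m + 1) * b = n then monomial (a + m * b) c else 0).coeff e = 0 := by
          split_ifs with h1
          · rw [coeff_monomial, if_neg fun h2 => h ⟨h1, h2⟩]
          · simp
        rw [hl]
        split_ifs with h1 h2
        · rw [coeff_monomial, if_neg fun h3 => h' ⟨h1, h2, h3⟩]
        · simp
        · rfl

theorem toric_injective (m : ℕ) : Function.Injective (toric k m) := by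
  rw [injective_iff_map_eq_zero]
  intro f hf
  ext a b
  have h := coeff_toric m f (2 * a + (2 * m + 1) * b) (a + m * b)
  have h1 : (2 * m + 1) * b = 2 * (m * b) + b := by ring
  have h2 : 2 * a + (2 * m + 1) * b - 2 * (a + m * b) = b := by omega
  rw [h2, if_pos ⟨by omega, by omega⟩, Nat.add_sub_cancel, hf] at h
  simpa using h.symm

/-- If `f(0, y)` has order `D ≥ 1` at `y = 0`, the quotient of the transform of `f` by the
exceptional divisor has order less than `D` at the point `u = 1` of this divisor. -/
theorem exists_toric_eq (m : ℕ) {D : ℕ} (hD : 1 ≤ D) {f : k[X][X]} (h1 : X ^ D ∣ f.coeff 0)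
    (h2 : ¬ X ^ (D + 1) ∣ f.coeff 0) :
    ∃ (N : ℕ) (G : k[X][X]), toric k m f = X ^ N * G ∧ ¬ (X - C 1) ^ D ∣ G.coeff 0 := by
  classical
  have hcD : (f.coeff 0).coeff D ≠ 0 := by
    intro h0
    refine h2 (X_pow_dvd_iff.2 fun d hd => ?_)
    rcases Nat.lt_succ_iff_lt_or_eq.1 hd with hd | rfl
    · exact X_pow_dvd_iff.1 h1 d hd
    · exact h0
  -- The monomial $y^D$ of $f$ is the only one sent to $s^{(2m+1)D}u^{mD}$, so the $s$-order $N$ of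
  -- the transform is at most $(2m+1)D$.
  have hn0 : (toric k m f).coeff ((2 * m + 1) * D) ≠ 0 := by
    intro h0
    have h := coeff_toric m f ((2 * m + 1) * D) (m * D)
    have e1 : (2 * m + 1) * D = 2 * (m * D) + D := by ring
    have e2 : (2 * m + 1) * D - 2 * (m * D) = D := by omega
    rw [e2, if_pos ⟨by omega, le_rfl⟩, Nat.sub_self, h0, coeff_zero] at h
    exact hcD h.symm
  have hex : ∃ n, (toric k m f).coeff n ≠ 0 := ⟨_, hn0⟩
  have hNle : Nat.find hex ≤ (2 * m + 1) * D := Nat.find_min' hex hn0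
  have hNspec := Nat.find_spec hex
  have hNmin : ∀ d < Nat.find hex, (toric k m f).coeff d = 0 := fun d hd =>
    not_not.1 (Nat.find_min hex hd)
  generalize Nat.find hex = N at *
  obtain ⟨G, hG⟩ := X_pow_dvd_iff.2 hNmin
  refine ⟨N, G, hG, fun hdvd => ?_⟩
  have hG0 : G.coeff 0 = (toric k m f).coeff N := by
    rw [hG]
    simpa using (coeff_X_pow_mul G N 0).symm
  rw [hG0] at hdvd
  set h := (toric k m f).coeff N with hh
  -- A term $u^e$ of `h` comes from $y$-exponent $b=N-2e$, and $(2m+1)b\le N\le(2m+1)D$ gives $b\le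
  -- D$. The exponents $e$ thus span at most $D/2$. After removing the power of $u$, which is
  -- coprime to $u-1$, too little degree is left for the factor $(u-1)^D$.
  have hsupp : ∀ e, h.coeff e ≠ 0 → 2 * e ≤ N ∧ N ≤ 2 * e + D := by
    intro e he
    rw [hh, coeff_toric] at he
    have hc : 2 * e ≤ N ∧ m * (N - 2 * e) ≤ e := by
      by_contra hc
      exact he (if_neg hc)
    refine ⟨hc.1, ?_⟩
    have e1 : (2 * m + 1) * (N - 2 * e) ≤ (2 * m + 1) * D := by
      have : (2 * m + 1) * (N - 2 * e) = 2 * (m * (N - 2 * e)) + (N - 2 * e) := by ring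
      omega
    have := Nat.le_of_mul_le_mul_left e1 (by omega)
    omega
  obtain ⟨e, q, hq, hhq⟩ := WfDvdMonoid.max_power_factor hNspec (irreducible_X (R := k))
  have hq0 : q ≠ 0 := by
    rintro rfl
    exact hq (dvd_zero _)
  have hcop : IsCoprime ((X - C 1 : k[X]) ^ D) (X ^ e) := by
    refine IsCoprime.pow ⟨-1, 1, ?_⟩
    simp
  have hdq : (X - C 1 : k[X]) ^ D ∣ q := hcop.dvd_of_dvd_mul_left (hhq ▸ hdvd)
  have hdeg := natDegree_le_of_dvd hdq hq0
  rw [natDegree_pow, natDegree_X_sub_C, mul_one] at hdeg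
  have hqc0 : q.coeff 0 ≠ 0 := fun h0 => hq (X_dvd_iff.2 h0)
  have s1 := hsupp e (by rw [hhq]; simpa [coeff_X_pow_mul'] using hqc0)
  have s2 := hsupp (q.natDegree + e) (by
    rw [hhq, coeff_X_pow_mul]
    exact leadingCoeff_ne_zero.2 hq0)
  omega

/-- The translation `u ↦ y + 1` of the inner variable. -/
noncomputable def shift (k : Type*) [Field k] : k[X][X] →+* k[X][X] :=
  mapRingHom (compRingHom (X + 1))

theorem shift_injective : Function.Injective (shift k) := by
  refine map_injective _ fun p q hpq => ?_
  have h : ∀ p : k[X], (p.comp (X + 1)).comp (X - 1) = p := fun p => by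
    rw [comp_assoc]
    simp
  rw [← h p, ← h q]
  exact congrArg (fun p => p.comp (X - 1)) hpq

/-- The substitution `x ↦ s² (t + 1)`, `y ↦ s ^ (2 m + 1) (t + 1) ^ m`. -/
noncomputable def blowupSubst (k : Type*) [Field k] (m : ℕ) : k[X][X] →+* k[X][X] :=
  (shift k).comp (toric k m)

theorem blowupSubst_injective (m : ℕ) : Function.Injective (blowupSubst k m) :=
  shift_injective.comp (toric_injective m)

theorem exists_blowupSubst_eq (m : ℕ) {D : ℕ} (hD : 1 ≤ D) {f : k[X][X]} (h1 : X ^ D ∣ f.coeff 0)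
    (h2 : ¬ X ^ (D + 1) ∣ f.coeff 0) :
    ∃ (N : ℕ) (g : k[X][X]), blowupSubst k m f = X ^ N * g ∧ ¬ X ^ D ∣ g.coeff 0 := by
  obtain ⟨N, G, hG, hnd⟩ := exists_toric_eq m hD h1 h2
  refine ⟨N, shift k G, ?_, fun hdvd => hnd ?_⟩
  · rw [blowupSubst, RingHom.comp_apply, hG, map_mul, map_pow]
    simp [shift]
  · have := map_dvd (compRingHom (X - 1 : k[X])) hdvd
    simpa [shift, comp_assoc] using this

/-- The value of a polynomial in two variables at the origin. -/
noncomputable def constCoeff (k : Type*) [Field k] : k[X][X] →+* k :=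
  constantCoeff.comp constantCoeff

theorem constCoeff_blowupSubst (m : ℕ) (f : k[X][X]) :
    constCoeff k (blowupSubst k m f) = constCoeff k f := by
  have : (constCoeff k).comp (blowupSubst k m) = constCoeff k := by
    ext <;> simp [constCoeff, blowupSubst, shift, toric]
  exact RingHom.congr_fun this f

end Toric

/-! ### Towers of parameters in $K$ -/

section Evaluation

variable {k K : Type*} [Field k] [Field K] [Algebra k K]

/-- Evaluation of a polynomial in two variables. -/
noncomputable def evalAt (k : Type*) {K : Type*} [Field k] [Field K] [Algebra k K] (x y : K) :
    k[X][X] →+* K :=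
  eval₂RingHom (aeval y).toRingHom x

theorem evalAt_X (x y : K) : evalAt k x y X = x := by simp [evalAt]

theorem evalAt_C_X (x y : K) : evalAt k x y (C X) = y := by simp [evalAt]

theorem evalAt_C_C (x y : K) (c : k) : evalAt k x y (C (C c)) = algebraMap k K c := by
  simp [evalAt]

theorem evalAt_toric (m : ℕ) (s u : K) (f : k[X][X]) :
    evalAt k (s ^ 2 * u) (s ^ (2 * m + 1) * u ^ m) f = evalAt k s u (toric k m f) := by
  have : evalAt k (s ^ 2 * u) (s ^ (2 * m + 1) * u ^ m) = (evalAt k s u).comp (toric k m) := by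
    ext <;> simp [toric, evalAt_X, evalAt_C_X, evalAt_C_C]
    ring
  exact RingHom.congr_fun this f

theorem evalAt_shift (s t : K) (f : k[X][X]) :
    evalAt k s (t + 1) f = evalAt k s t (shift k f) := by
  have : evalAt k s (t + 1) = (evalAt k s t).comp (shift k) := by
    ext <;> simp [evalAt, shift]
  exact RingHom.congr_fun this f

end Evaluation

section Tower

variable {k K : Type*} [Field k] [Field K] [Algebra k K]

theorem blowupSubst_X (m : ℕ) : blowupSubst k m X = X ^ 2 * (C X + 1) := by
  simp [blowupSubst, toric, shift]
  ring

theorem blowupSubst_C_X (m : ℕ) :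
    blowupSubst k m (C X) = X ^ (2 * m + 1) * (C X + 1) ^ m := by
  simp [blowupSubst, toric, shift]

theorem blowupSubst_C_C (m : ℕ) (c : k) : blowupSubst k m (C (C c)) = C (C c) := by
  simp [blowupSubst, toric, shift]

/-- The new variables are rational functions of the old ones, $s=y/x^m$ and $t=x^{2m+1}/y^2-1$; the
statement clears denominators. It transfers algebraic independence of the parameters to the next
level. -/
theorem exists_blowupSubst_mul_eq (m : ℕ) (g : k[X][X]) :
    ∃ s h, s ≠ 0 ∧ blowupSubst k m s * g = blowupSubst k m h := by
  have hadd : ∀ g g' : k[X][X], (∃ s h, s ≠ 0 ∧ blowupSubst k m s * g = blowupSubst k m h) →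
      (∃ s h, s ≠ 0 ∧ blowupSubst k m s * g' = blowupSubst k m h) →
      ∃ s h, s ≠ 0 ∧ blowupSubst k m s * (g + g') = blowupSubst k m h := by
    rintro g g' ⟨s, h, hs, e⟩ ⟨s', h', hs', e'⟩
    refine ⟨s * s', h * s' + s * h', mul_ne_zero hs hs', ?_⟩
    rw [map_add, map_mul, map_mul, map_mul, ← e, ← e']
    ring
  have hmul : ∀ g g' : k[X][X], (∃ s h, s ≠ 0 ∧ blowupSubst k m s * g = blowupSubst k m h) →
      (∃ s h, s ≠ 0 ∧ blowupSubst k m s * g' = blowupSubst k m h) →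
      ∃ s h, s ≠ 0 ∧ blowupSubst k m s * (g * g') = blowupSubst k m h := by
    rintro g g' ⟨s, h, hs, e⟩ ⟨s', h', hs', e'⟩
    refine ⟨s * s', h * h', mul_ne_zero hs hs', ?_⟩
    rw [map_mul, map_mul, ← e, ← e']
    ring
  have hpow : ∀ g : k[X][X], (∃ s h, s ≠ 0 ∧ blowupSubst k m s * g = blowupSubst k m h) →
      ∀ n : ℕ, ∃ s h, s ≠ 0 ∧ blowupSubst k m s * g ^ n = blowupSubst k m h := by
    rintro g ⟨s, h, hs, e⟩ n
    exact ⟨s ^ n, h ^ n, pow_ne_zero n hs, by rw [map_pow, ← mul_pow, e, map_pow]⟩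
  have hX : ∃ s h, s ≠ 0 ∧ blowupSubst k m s * X = blowupSubst k m h := by
    refine ⟨X ^ m, C X, pow_ne_zero m X_ne_zero, ?_⟩
    rw [map_pow, blowupSubst_X, blowupSubst_C_X, mul_pow, ← pow_mul]
    ring
  have hCX : ∃ s h, s ≠ 0 ∧ blowupSubst k m s * C X = blowupSubst k m h := by
    refine ⟨C X ^ 2, X ^ (2 * m + 1) - C X ^ 2, pow_ne_zero 2 (by simp), ?_⟩
    rw [map_sub, map_pow, map_pow, blowupSubst_X, blowupSubst_C_X, mul_pow, mul_pow, ← pow_mul,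
      ← pow_mul, ← pow_mul]
    ring
  induction g using Polynomial.induction_on' with
  | add g g' h h' => exact hadd g g' h h'
  | monomial a p =>
    rw [← C_mul_X_pow_eq_monomial]
    refine hmul _ _ ?_ (hpow X hX a)
    induction p using Polynomial.induction_on' with
    | add p p' h h' => rw [C_add]; exact hadd _ _ h h'
    | monomial b c =>
      rw [← C_mul_X_pow_eq_monomial, C_mul, C_pow]
      exact hmul _ _ ⟨1, C (C c), one_ne_zero, by rw [map_one, one_mul, blowupSubst_C_C]⟩
        (hpow _ hCX b)

theorem evalAt_blowupSubst {m : ℕ} {x y s t : K} (hx : x = s ^ 2 * (t + 1))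
    (hy : y = s ^ (2 * m + 1) * (t + 1) ^ m) (f : k[X][X]) :
    evalAt k x y f = evalAt k s t (blowupSubst k m f) := by
  rw [hx, hy, evalAt_toric, evalAt_shift, blowupSubst, RingHom.comp_apply]

theorem evalAt_injective_of_blowupSubst {m : ℕ} {x y s t : K} (hx : x = s ^ 2 * (t + 1))
    (hy : y = s ^ (2 * m + 1) * (t + 1) ^ m) (hinj : Function.Injective (evalAt k x y)) :
    Function.Injective (evalAt k s t) := by
  rw [injective_iff_map_eq_zero]
  intro g hg
  obtain ⟨f, h, hf, e⟩ := exists_blowupSubst_mul_eq m g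
  have h0 : h = 0 := by
    rw [injective_iff_map_eq_zero] at hinj
    refine hinj h ?_
    rw [evalAt_blowupSubst hx hy, ← e, map_mul, hg, mul_zero]
  rw [h0, map_zero] at e
  refine (mul_eq_zero.1 e).resolve_left fun h1 => hf ?_
  exact blowupSubst_injective m (by rw [h1, map_zero])

/-- The parameters `xₙ`, `yₙ` obtained from the generators of `K` over `k` by the substitutions
`xₙ = xₙ₊₁² (yₙ₊₁ + 1)`, `yₙ = xₙ ^ mₙ xₙ₊₁`. -/
structure IsParameterTower (k : Type*) {K : Type*} [Field k] [Field K] [Algebra k K] (m : ℕ → ℕ)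
    (x y : ℕ → K) : Prop where
  eq_x : ∀ n, x n = x (n + 1) ^ 2 * (y (n + 1) + 1)
  eq_y : ∀ n, y n = x (n + 1) ^ (2 * m n + 1) * (y (n + 1) + 1) ^ m n
  injective : ∀ n, Function.Injective (evalAt k (x n) (y n))
  exists_div : ∀ z : K, ∃ f g, z = evalAt k (x 0) (y 0) f / evalAt k (x 0) (y 0) g

theorem exists_isParameterTower (m : ℕ → ℕ) {x₀ y₀ : K}
    (hinj : Function.Injective (evalAt k x₀ y₀))
    (hdiv : ∀ z : K, ∃ f g, z = evalAt k x₀ y₀ f / evalAt k x₀ y₀ g) :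
    ∃ x y : ℕ → K, x 0 = x₀ ∧ y 0 = y₀ ∧ IsParameterTower k m x y := by
  -- The tower relations solved for the new pair: $x_{n+1}=y_n/x_n^{m_n}$ and
  -- $y_{n+1}=x_n/x_{n+1}^2-1$.
  let P : ℕ → K × K := fun n => Nat.rec (x₀, y₀)
    (fun n p => (p.2 / p.1 ^ m n, p.1 / (p.2 / p.1 ^ m n) ^ 2 - 1)) n
  have hstep : ∀ n, Function.Injective (evalAt k (P n).1 (P n).2) →
      (P n).1 = (P (n + 1)).1 ^ 2 * ((P (n + 1)).2 + 1) ∧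
      (P n).2 = (P (n + 1)).1 ^ (2 * m n + 1) * ((P (n + 1)).2 + 1) ^ m n := by
    intro n hn
    have hx : (P n).1 ≠ 0 := by
      rw [← evalAt_X (k := k) (P n).1 (P n).2, (map_ne_zero_iff _ hn)]
      exact X_ne_zero
    have hy : (P n).2 ≠ 0 := by
      rw [← evalAt_C_X (k := k) (P n).1 (P n).2, (map_ne_zero_iff _ hn)]
      simp
    have h1 : (P (n + 1)).1 = (P n).2 / (P n).1 ^ m n := rfl
    have h2 : (P (n + 1)).2 = (P n).1 / (P (n + 1)).1 ^ 2 - 1 := rfl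
    have hs : (P (n + 1)).1 ≠ 0 := h1 ▸ div_ne_zero hy (pow_ne_zero _ hx)
    have e1 : (P n).1 = (P (n + 1)).1 ^ 2 * ((P (n + 1)).2 + 1) := by
      rw [h2]
      field_simp
      ring
    refine ⟨e1, ?_⟩
    rw [pow_succ, pow_mul, mul_right_comm, ← mul_pow, ← e1, h1]
    field_simp
  have hinj' : ∀ n, Function.Injective (evalAt k (P n).1 (P n).2) := by
    intro n
    induction n with
    | zero => exact hinj
    | succ n ih => exact evalAt_injective_of_blowupSubst (hstep n ih).1 (hstep n ih).2 ih
  exact ⟨fun n => (P n).1, fun n => (P n).2, rfl, rfl, fun n => (hstep n (hinj' n)).1,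
    fun n => (hstep n (hinj' n)).2, hinj', hdiv⟩

namespace IsParameterTower

variable {m : ℕ → ℕ} {x y : ℕ → K} (h : IsParameterTower k m x y)
include h

theorem x_ne_zero (n : ℕ) : x n ≠ 0 := by
  rw [← evalAt_X (k := k) (x n) (y n), map_ne_zero_iff _ (h.injective n)]
  exact X_ne_zero

theorem evalAt_ne_zero {n : ℕ} {f : k[X][X]} (hf : f ≠ 0) : evalAt k (x n) (y n) f ≠ 0 :=
  (map_ne_zero_iff _ (h.injective n)).2 hf

omit h in
theorem ne_zero_of_constCoeff_ne_zero {f : k[X][X]} (hf : constCoeff k f ≠ 0) : f ≠ 0 := by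
  rintro rfl
  exact hf (map_zero _)

theorem evalAt_succ (n : ℕ) (f : k[X][X]) :
    evalAt k (x n) (y n) f = evalAt k (x (n + 1)) (y (n + 1)) (blowupSubst k (m n) f) :=
  evalAt_blowupSubst (h.eq_x n) (h.eq_y n) f

theorem exists_evalAt_eq {i j : ℕ} (hij : i ≤ j) (f : k[X][X]) :
    ∃ g, constCoeff k g = constCoeff k f ∧
      evalAt k (x i) (y i) f = evalAt k (x j) (y j) g := by
  induction j, hij using Nat.le_induction with
  | base => exact ⟨f, rfl, rfl⟩
  | succ j _ ih =>
    obtain ⟨g, hg, e⟩ := ih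
    exact ⟨blowupSubst k (m j) g, by rw [constCoeff_blowupSubst, hg], by rw [e, h.evalAt_succ]⟩

theorem exists_x_eq {i j : ℕ} (hij : i ≤ j) :
    ∃ g, constCoeff k g ≠ 0 ∧ x i = x j ^ 2 ^ (j - i) * evalAt k (x j) (y j) g := by
  induction j, hij using Nat.le_induction with
  | base => exact ⟨1, by simp, by simp⟩
  | succ j hj ih =>
    obtain ⟨g, hg, e⟩ := ih
    refine ⟨(C X + 1) ^ 2 ^ (j - i) * blowupSubst k (m j) g, ?_, ?_⟩
    · rw [map_mul, constCoeff_blowupSubst, map_pow]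
      refine mul_ne_zero (pow_ne_zero _ ?_) hg
      simp [constCoeff]
    · rw [e, h.evalAt_succ, Nat.succ_sub hj, pow_succ, map_mul, map_pow, map_add, map_one,
        evalAt_C_X]
      nth_rw 1 [h.eq_x j]
      rw [mul_pow, ← pow_mul, mul_comm 2, mul_assoc]

/-- Induction on a bound `D` for the order of $f(0,y)$. By `exists_blowupSubst_eq` one step of the
tower lowers this order after a power of $x_{i+1}$ is split off, and `exists_x_eq` rewrites that
power at the final level. Order zero means that $f$ is a unit at the origin. -/
theorem exists_eq_pow_mul_of_not_dvd (D : ℕ) : ∀ (i : ℕ) (f : k[X][X]), ¬ X ^ (D + 1) ∣ f.coeff 0 →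
    ∃ j, i ≤ j ∧ ∃ (N : ℕ) (g : k[X][X]), constCoeff k g ≠ 0 ∧
      evalAt k (x i) (y i) f = x j ^ N * evalAt k (x j) (y j) g := by
  induction D with
  | zero =>
    intro i f hf
    refine ⟨i, le_rfl, 0, f, ?_, by simp⟩
    rw [zero_add, pow_one, X_dvd_iff] at hf
    simpa [constCoeff] using hf
  | succ D ih =>
    intro i f hf
    by_cases hf' : X ^ (D + 1) ∣ f.coeff 0
    · obtain ⟨N, g, e, hg⟩ := exists_blowupSubst_eq (m i) (Nat.succ_pos D) hf' hf
      obtain ⟨j, hj, M, g', hg', e'⟩ := ih (i + 1) g hg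
      obtain ⟨w, hw, ew⟩ := h.exists_x_eq hj
      refine ⟨j, by omega, 2 ^ (j - (i + 1)) * N + M, w ^ N * g', ?_, ?_⟩
      · rw [map_mul, map_pow]
        exact mul_ne_zero (pow_ne_zero N hw) hg'
      · rw [h.evalAt_succ, e, map_mul, map_pow, evalAt_X, e', ew, map_mul, map_pow, pow_add, pow_mul,
          mul_pow]
        ring
    · exact ih i f hf'

/-- Every nonzero polynomial in `xᵢ`, `yᵢ` is a monomial in `xⱼ` times a unit, for some `j`. -/
theorem exists_eq_pow_mul (i : ℕ) {f : k[X][X]} (hf : f ≠ 0) :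
    ∃ j, i ≤ j ∧ ∃ (N : ℕ) (g : k[X][X]), constCoeff k g ≠ 0 ∧
      evalAt k (x i) (y i) f = x j ^ N * evalAt k (x j) (y j) g := by
  -- Removing the power of the outer variable makes $f'(0,y)$ nonzero, and its degree then bounds
  -- its order.
  obtain ⟨a, f', hf', rfl⟩ := WfDvdMonoid.max_power_factor hf (irreducible_X (R := k[X]))
  have hc : f'.coeff 0 ≠ 0 := fun h0 => hf' (X_dvd_iff.2 h0)
  have hnd : ¬ X ^ ((f'.coeff 0).natDegree + 1) ∣ f'.coeff 0 := fun hdvd => by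
    have := natDegree_le_of_dvd hdvd hc
    rw [natDegree_X_pow] at this
    omega
  obtain ⟨j, hj, N, g, hg, e⟩ := h.exists_eq_pow_mul_of_not_dvd _ i f' hnd
  obtain ⟨w, hw, ew⟩ := h.exists_x_eq hj
  refine ⟨j, hj, 2 ^ (j - i) * a + N, w ^ a * g, ?_, ?_⟩
  · rw [map_mul, map_pow]
    exact mul_ne_zero (pow_ne_zero a hw) hg
  · rw [map_mul, map_pow, evalAt_X, e, ew, map_mul, map_pow, pow_add, pow_mul, mul_pow]
    ring

end IsParameterTower

end Tower

/-! ### The valuation attached to a tower -/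

section Tower

variable {k K : Type*} [Field k] [Field K] [Algebra k K]

/-- `u` is a unit of the localization of `k[x, y]` at the origin. -/
def IsLocalUnit (k : Type*) {K : Type*} [Field k] [Field K] [Algebra k K] (x y u : K) : Prop :=
  ∃ f g, constCoeff k f ≠ 0 ∧ constCoeff k g ≠ 0 ∧ u = evalAt k x y f / evalAt k x y g

theorem IsLocalUnit.of_constCoeff_ne_zero (x y : K) {f : k[X][X]} (hf : constCoeff k f ≠ 0) :
    IsLocalUnit k x y (evalAt k x y f) :=
  ⟨f, 1, hf, by simp, by simp⟩

theorem IsLocalUnit.one (x y : K) : IsLocalUnit k x y (1 : K) := ⟨1, 1, by simp, by simp, by simp⟩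

theorem IsLocalUnit.mul {x y u w : K} (hu : IsLocalUnit k x y u) (hw : IsLocalUnit k x y w) :
    IsLocalUnit k x y (u * w) := by
  obtain ⟨f, g, hf, hg, rfl⟩ := hu
  obtain ⟨f', g', hf', hg', rfl⟩ := hw
  refine ⟨f * f', g * g', ?_, ?_, ?_⟩
  · rw [map_mul]; exact mul_ne_zero hf hf'
  · rw [map_mul]; exact mul_ne_zero hg hg'
  · rw [map_mul, map_mul, div_mul_div_comm]

theorem IsLocalUnit.inv {x y u : K} (hu : IsLocalUnit k x y u) : IsLocalUnit k x y u⁻¹ := by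
  obtain ⟨f, g, hf, hg, rfl⟩ := hu
  exact ⟨g, f, hg, hf, inv_div _ _⟩

theorem IsLocalUnit.zpow {x y u : K} (hu : IsLocalUnit k x y u) (n : ℤ) :
    IsLocalUnit k x y (u ^ n) := by
  have hpow : ∀ n : ℕ, IsLocalUnit k x y (u ^ n) := by
    intro n
    induction n with
    | zero => rw [pow_zero]; exact .one x y
    | succ n ih => rw [pow_succ]; exact ih.mul hu
  cases n with
  | ofNat n => rw [Int.ofNat_eq_natCast, zpow_natCast]; exact hpow n
  | negSucc n => rw [zpow_negSucc]; exact (hpow _).inv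

/-- `z` is a power of some `xⱼ` times a unit, with `r` the value of this power if `xⱼ` has value
`2⁻ʲ`. -/
def HasValue (k : Type*) {K : Type*} [Field k] [Field K] [Algebra k K] (x y : ℕ → K) (z : K)
    (r : ℝ) : Prop :=
  ∃ (j : ℕ) (n : ℤ) (u : K), IsLocalUnit k (x j) (y j) u ∧ z = x j ^ n * u ∧ r = n * (1 / 2) ^ j

namespace IsParameterTower

variable {m : ℕ → ℕ} {x y : ℕ → K} (h : IsParameterTower k m x y)
include h

theorem isLocalUnit_ne_zero {j : ℕ} {u : K} (hu : IsLocalUnit k (x j) (y j) u) : u ≠ 0 := by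
  obtain ⟨f, g, hf, hg, rfl⟩ := hu
  exact div_ne_zero (h.evalAt_ne_zero (ne_zero_of_constCoeff_ne_zero hf))
    (h.evalAt_ne_zero (ne_zero_of_constCoeff_ne_zero hg))

theorem isLocalUnit_mono {i j : ℕ} (hij : i ≤ j) {u : K} (hu : IsLocalUnit k (x i) (y i) u) :
    IsLocalUnit k (x j) (y j) u := by
  obtain ⟨f, g, hf, hg, rfl⟩ := hu
  obtain ⟨f', hf', ef⟩ := h.exists_evalAt_eq hij f
  obtain ⟨g', hg', eg⟩ := h.exists_evalAt_eq hij g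
  exact ⟨f', g', hf' ▸ hf, hg' ▸ hg, by rw [ef, eg]⟩

theorem exists_zpow_mul_eq {i j : ℕ} (hij : i ≤ j) (n : ℤ) {u : K}
    (hu : IsLocalUnit k (x i) (y i) u) :
    ∃ (n' : ℤ) (w : K), IsLocalUnit k (x j) (y j) w ∧ x i ^ n * u = x j ^ n' * w ∧
      (n : ℝ) * (1 / 2) ^ i = n' * (1 / 2) ^ j := by
  obtain ⟨w, hw, e⟩ := h.exists_x_eq hij
  refine ⟨2 ^ (j - i) * n, _, ((IsLocalUnit.of_constCoeff_ne_zero _ _ hw).zpow n).mul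
    (h.isLocalUnit_mono hij hu), ?_, ?_⟩
  · conv_lhs => rw [e]
    rw [mul_zpow, zpow_mul, mul_assoc]
    norm_cast
  · obtain ⟨d, rfl⟩ := Nat.exists_eq_add_of_le hij
    rw [Nat.add_sub_cancel_left, pow_add]
    push_cast
    have : (2 : ℝ) ^ d * (1 / 2) ^ d = 1 := by rw [← mul_pow]; norm_num
    linear_combination (-(n : ℝ) * (1 / 2) ^ i) * this

/-- Two elements with a value can be written in terms of the same `xⱼ`. -/
theorem exists_common_level {z w : K} {r s : ℝ} (hz : HasValue k x y z r)
    (hw : HasValue k x y w s) : ∃ (j : ℕ) (n n' : ℤ) (u u' : K), IsLocalUnit k (x j) (y j) u ∧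
      IsLocalUnit k (x j) (y j) u' ∧ z = x j ^ n * u ∧ w = x j ^ n' * u' ∧
      r = n * (1 / 2) ^ j ∧ s = n' * (1 / 2) ^ j := by
  obtain ⟨i, n, u, hu, rfl, rfl⟩ := hz
  obtain ⟨i', n', u', hu', rfl, rfl⟩ := hw
  obtain ⟨N, a, ha, e1, e2⟩ := h.exists_zpow_mul_eq (le_max_left i i') n hu
  obtain ⟨N', a', ha', e1', e2'⟩ := h.exists_zpow_mul_eq (le_max_right i i') n' hu'
  exact ⟨_, N, N', a, a', ha, ha', e1, e1', e2, e2'⟩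

theorem hasValue_mul {z w : K} {r s : ℝ} (hz : HasValue k x y z r) (hw : HasValue k x y w s) :
    HasValue k x y (z * w) (r + s) := by
  obtain ⟨j, n, n', u, u', hu, hu', rfl, rfl, rfl, rfl⟩ := h.exists_common_level hz hw
  refine ⟨j, n + n', u * u', hu.mul hu', ?_, by push_cast; ring⟩
  rw [zpow_add₀ (h.x_ne_zero j)]
  ring

omit h in
theorem hasValue_inv {z : K} {r : ℝ} (hz : HasValue k x y z r) : HasValue k x y z⁻¹ (-r) := by
  obtain ⟨j, n, u, hu, rfl, rfl⟩ := hz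
  exact ⟨j, -n, u⁻¹, hu.inv, by rw [mul_inv, zpow_neg], by push_cast; ring⟩

omit h in
theorem hasValue_of_isLocalUnit {j : ℕ} {u : K} (hu : IsLocalUnit k (x j) (y j) u) :
    HasValue k x y u 0 :=
  ⟨j, 0, u, hu, by simp, by simp⟩

omit h in
theorem hasValue_zpow (j : ℕ) (n : ℤ) : HasValue k x y (x j ^ n) (n * (1 / 2) ^ j) :=
  ⟨j, n, 1, .one _ _, by simp, rfl⟩

theorem ne_zero_of_hasValue {z : K} {r : ℝ} (hz : HasValue k x y z r) : z ≠ 0 := by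
  obtain ⟨j, n, u, hu, rfl, rfl⟩ := hz
  exact mul_ne_zero (zpow_ne_zero n (h.x_ne_zero j)) (h.isLocalUnit_ne_zero hu)

theorem hasValue_evalAt (i : ℕ) {f : k[X][X]} (hf : f ≠ 0) :
    ∃ r, 0 ≤ r ∧ (constCoeff k f = 0 → 0 < r) ∧ HasValue k x y (evalAt k (x i) (y i) f) r := by
  obtain ⟨j, hj, N, g, hg, e⟩ := h.exists_eq_pow_mul i hf
  refine ⟨N * (1 / 2) ^ j, by positivity, fun hc => ?_, j, N, _,
    .of_constCoeff_ne_zero _ _ hg, by rw [e, zpow_natCast], by simp⟩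
  rcases Nat.eq_zero_or_pos N with rfl | hN
  · exfalso
    obtain ⟨f', hf', e'⟩ := h.exists_evalAt_eq hj f
    rw [e', pow_zero, one_mul] at e
    rw [← h.injective j e, hf'] at hg
    exact hg hc
  · positivity

theorem exists_hasValue {z : K} (hz : z ≠ 0) : ∃ r, HasValue k x y z r := by
  obtain ⟨f, g, rfl⟩ := h.exists_div z
  have hf : f ≠ 0 := by rintro rfl; simp at hz
  have hg : g ≠ 0 := by rintro rfl; simp at hz
  obtain ⟨r, -, -, hr⟩ := h.hasValue_evalAt 0 hf
  obtain ⟨s, -, -, hs⟩ := h.hasValue_evalAt 0 hg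
  rw [div_eq_mul_inv]
  exact ⟨_, h.hasValue_mul hr (hasValue_inv hs)⟩

/-- This is what makes the value well defined: $x_j^af=g$ with $g$ nonzero at the origin forces
$a=0$, since evaluation at the parameters is injective. -/
theorem eq_zero_of_hasValue_one {r : ℝ} (hr : HasValue k x y (1 : K) r) : r = 0 := by
  have key : ∀ (j a : ℕ) (u : K), IsLocalUnit k (x j) (y j) u → x j ^ a * u = 1 → a = 0 := by
    rintro j a _ ⟨f, g, hf, hg, rfl⟩ e
    have hg0 := h.evalAt_ne_zero (n := j) (ne_zero_of_constCoeff_ne_zero hg)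
    rw [mul_div_assoc', div_eq_one_iff_eq hg0] at e
    have e' : X ^ a * f = g := h.injective j (by rw [map_mul, map_pow, evalAt_X, e])
    by_contra ha
    rw [← e', map_mul, map_pow] at hg
    refine hg ?_
    simp [constCoeff, ha]
  obtain ⟨j, n, u, hu, e, rfl⟩ := hr
  rcases Int.eq_nat_or_neg n with ⟨a, rfl | rfl⟩
  · rw [key j a u hu (by rw [e, zpow_natCast])]
    simp
  · rw [key j a u⁻¹ hu.inv (by rw [← inv_one, e, mul_inv, zpow_neg, inv_inv, zpow_natCast])]
    simp

theorem hasValue_unique {z : K} {r s : ℝ} (hr : HasValue k x y z r) (hs : HasValue k x y z s) :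
    r = s := by
  have := h.hasValue_mul hr (hasValue_inv hs)
  rw [mul_inv_cancel₀ (h.ne_zero_of_hasValue hr)] at this
  linarith [h.eq_zero_of_hasValue_one this]

/-- At a common level the smaller power of $x_j$ factors out, leaving a polynomial divided by a
local unit; nonzero polynomials in the parameters have nonnegative value. -/
theorem hasValue_add {z w : K} {r s : ℝ} (hz : HasValue k x y z r) (hw : HasValue k x y w s)
    (hrs : r ≤ s) (hne : z + w ≠ 0) : ∃ t, r ≤ t ∧ HasValue k x y (z + w) t := by
  obtain ⟨j, n, n', u, u', ⟨f, g, hf, hg, rfl⟩, ⟨f', g', hf', hg', rfl⟩, rfl, rfl, rfl, rfl⟩ :=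
    h.exists_common_level hz hw
  have hnn : n ≤ n' := by
    have := le_of_mul_le_mul_right hrs (by positivity)
    exact_mod_cast this
  obtain ⟨a, rfl⟩ := Int.le.dest hnn
  have hg0 := h.evalAt_ne_zero (n := j) (ne_zero_of_constCoeff_ne_zero hg)
  have hg0' := h.evalAt_ne_zero (n := j) (ne_zero_of_constCoeff_ne_zero hg')
  have e : x j ^ n * (evalAt k (x j) (y j) f / evalAt k (x j) (y j) g) +
      x j ^ (n + a) * (evalAt k (x j) (y j) f' / evalAt k (x j) (y j) g') =
      x j ^ n * (evalAt k (x j) (y j) (f * g' + X ^ a * f' * g) *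
        (evalAt k (x j) (y j) (g * g'))⁻¹) := by
    rw [zpow_add₀ (h.x_ne_zero j), zpow_natCast]
    simp only [map_add, map_mul, map_pow, evalAt_X]
    field_simp
  have hp : f * g' + X ^ a * f' * g ≠ 0 := by
    intro h0
    rw [e, h0] at hne
    simp at hne
  obtain ⟨t, ht, -, hv⟩ := h.hasValue_evalAt j hp
  have hgg : constCoeff k (g * g') ≠ 0 := by rw [map_mul]; exact mul_ne_zero hg hg'
  have hu := hasValue_of_isLocalUnit (x := x) (y := y)
    (IsLocalUnit.of_constCoeff_ne_zero (x j) (y j) hgg).inv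
  refine ⟨_, ?_, e ▸ h.hasValue_mul (hasValue_zpow j n) (h.hasValue_mul hv hu)⟩
  linarith

/-- The valuation with `v(xₙ) = 2⁻ⁿ`. -/
theorem exists_addValuation :
    ∃ v : AddValuation K (WithTop ℝ), ∀ z r, HasValue k x y z r → v z = r := by
  classical
  let f : K → WithTop ℝ := fun z =>
    if hz : z = 0 then ⊤ else (((h.exists_hasValue hz).choose : ℝ) : WithTop ℝ)
  have hf : ∀ z r, HasValue k x y z r → f z = r := by
    intro z r hr
    have hz := h.ne_zero_of_hasValue hr
    have := h.hasValue_unique (h.exists_hasValue hz).choose_spec hr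
    simp only [f, dif_neg hz, this]
  have hf0 : f 0 = ⊤ := dif_pos rfl
  refine ⟨AddValuation.of f hf0 ?_ ?_ ?_, hf⟩
  · rw [hf 1 0 (hasValue_of_isLocalUnit (j := 0) (.one _ _))]
    rfl
  · intro z w
    by_cases hz : z = 0
    · rw [hz, zero_add]; exact min_le_right _ _
    by_cases hw : w = 0
    · rw [hw, add_zero]; exact min_le_left _ _
    by_cases hne : z + w = 0
    · rw [hne, hf0]; exact le_top
    obtain ⟨r, hr⟩ := h.exists_hasValue hz
    obtain ⟨s, hs⟩ := h.exists_hasValue hw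
    rcases le_total r s with hrs | hrs
    · obtain ⟨t, ht, hv⟩ := h.hasValue_add hr hs hrs hne
      rw [hf _ _ hr, hf _ _ hv]
      exact (min_le_left _ _).trans (by exact_mod_cast ht)
    · obtain ⟨t, ht, hv⟩ := h.hasValue_add hs hr hrs (by rwa [add_comm])
      rw [add_comm] at hv
      rw [hf _ _ hs, hf _ _ hv]
      exact (min_le_right _ _).trans (by exact_mod_cast ht)
  · intro z w
    by_cases hz : z = 0
    · rw [hz, zero_mul, hf0, WithTop.top_add]
    by_cases hw : w = 0
    · rw [hw, mul_zero, hf0, WithTop.add_top]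
    obtain ⟨r, hr⟩ := h.exists_hasValue hz
    obtain ⟨s, hs⟩ := h.exists_hasValue hw
    rw [hf _ _ hr, hf _ _ hs, hf _ _ (h.hasValue_mul hr hs)]
    rfl

section Valuation

variable {v : AddValuation K (WithTop ℝ)} (hv : ∀ z r, HasValue k x y z r → v z = r)
include hv

omit h in
theorem map_x (n : ℕ) : v (x n) = (((1 / 2) ^ n : ℝ) : WithTop ℝ) :=
  hv _ _ ⟨n, 1, 1, .one _ _, by simp, by simp⟩

theorem map_y (n : ℕ) : v (y n) = ((m n * (1 / 2) ^ n + (1 / 2) ^ (n + 1) : ℝ) : WithTop ℝ) := by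
  refine hv _ _ ⟨n + 1, 2 * m n + 1, (y (n + 1) + 1) ^ (m n), ?_, ?_, ?_⟩
  · have h1 : constCoeff k (C X + 1) ≠ 0 := by simp [constCoeff]
    have := (IsLocalUnit.of_constCoeff_ne_zero (x (n + 1)) (y (n + 1)) h1).zpow (m n)
    rwa [zpow_natCast, map_add, map_one, evalAt_C_X] at this
  · rw [h.eq_y n]
    norm_cast
  · push_cast
    ring

omit h in
theorem map_algebraMap {c : k} (hc : c ≠ 0) : v (algebraMap k K c) = 0 := by
  rw [← evalAt_C_C (x 0) (y 0) c]
  exact hv _ _ (hasValue_of_isLocalUnit (.of_constCoeff_ne_zero _ _ (by simpa [constCoeff])))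

theorem exists_rat_of_map_eq {z : K} {γ : ℝ} (hz : v z = γ) : ∃ r : ℚ, γ = r * 1 := by
  have hz0 : z ≠ 0 := by rintro rfl; simp at hz
  obtain ⟨r, hr⟩ := h.exists_hasValue hz0
  have hγ : γ = r := by
    have := hv _ _ hr
    rw [hz] at this
    exact_mod_cast this
  obtain ⟨j, n, -, -, -, rfl⟩ := hr
  exact ⟨n * (1 / 2) ^ j, by rw [hγ]; push_cast; ring⟩

/-- The residue field is $k$: an element of value zero is a local unit $f/g$, with residue
$f(0,0)/g(0,0)$. -/
theorem exists_algebraMap_sub_pos {z : K} (hz : 0 ≤ v z) :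
    ∃ c : k, 0 < v (z - algebraMap k K c) := by
  by_cases hz0 : z = 0
  · exact ⟨0, by simp [hz0]⟩
  obtain ⟨r, hr⟩ := h.exists_hasValue hz0
  have hvr := hv _ _ hr
  have hr0 : 0 ≤ r := by rw [hvr] at hz; exact_mod_cast hz
  rcases hr0.eq_or_lt with rfl | hr0
  · obtain ⟨j, n, u, ⟨f, g, hf, hg, rfl⟩, rfl, e⟩ := hr
    have hn : n = 0 := by
      have h2 : ((1 : ℝ) / 2) ^ j ≠ 0 := by positivity
      have := (mul_eq_zero.1 e.symm).resolve_right h2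
      exact_mod_cast this
    have hg0 := h.evalAt_ne_zero (n := j) (ne_zero_of_constCoeff_ne_zero hg)
    set c := constCoeff k f / constCoeff k g with hc
    refine ⟨c, ?_⟩
    have e1 : x j ^ n * (evalAt k (x j) (y j) f / evalAt k (x j) (y j) g) - algebraMap k K c =
        evalAt k (x j) (y j) (f - C (C c) * g) * (evalAt k (x j) (y j) g)⁻¹ := by
      rw [hn, zpow_zero, one_mul, map_sub, map_mul, evalAt_C_C]
      field_simp
    rw [e1]
    by_cases hp : f - C (C c) * g = 0
    · simp [hp]
    obtain ⟨t, -, ht, hvt⟩ := h.hasValue_evalAt j hp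
    have hcc : constCoeff k (f - C (C c) * g) = 0 := by
      have : constCoeff k (C (C c)) = c := by simp [constCoeff]
      rw [map_sub, map_mul, this, hc, div_mul_cancel₀ _ hg, sub_self]
    have hu := hasValue_of_isLocalUnit (x := x) (y := y)
      (IsLocalUnit.of_constCoeff_ne_zero (x j) (y j) hg).inv
    rw [hv _ _ (h.hasValue_mul hvt hu), add_zero]
    exact_mod_cast ht hcc
  · exact ⟨0, by rw [map_zero, sub_zero, hvr]; exact_mod_cast hr0⟩

end Valuation

end IsParameterTower

end Tower

/-! ### Enumeration of the individual quadratic transforms -/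

section States

/-- The positions `(k, i)` with `i ≤ m k + 1` in lexicographic order. -/
def nextState (m : ℕ → ℕ) (p : ℕ × ℕ) : ℕ × ℕ :=
  if p.2 ≤ m p.1 then (p.1, p.2 + 1) else (p.1 + 1, 0)

/-- Position $(k,i)$ stands for the ring with parameters $x_k,\ y_k/x_k^i$ if $i\le m_k$, and
$x_{k+1},\ x_k/x_{k+1}$ if $i=m_k+1$. Block $k$ has $m_k$ positions of value $2^{-k}$ followed by
two of value $2^{-(k+1)}$. -/
def state (m : ℕ → ℕ) (n : ℕ) : ℕ × ℕ := (nextState m)^[n] (0, 0)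

theorem state_succ (m : ℕ → ℕ) (n : ℕ) : state m (n + 1) = nextState m (state m n) :=
  Function.iterate_succ_apply' _ _ _

theorem state_snd_le (m : ℕ → ℕ) (n : ℕ) : (state m n).2 ≤ m (state m n).1 + 1 := by
  induction n with
  | zero => simp [state]
  | succ n ih =>
    rw [state_succ, nextState]
    split_ifs with h
    · simpa using h
    · simp

theorem exists_state_eq (m : ℕ → ℕ) (k : ℕ) : ∃ n, state m n = (k, 0) := by
  induction k with
  | zero => exact ⟨0, rfl⟩
  | succ k ih =>
    obtain ⟨n, hn⟩ := ih
    have h : ∀ i ≤ m k + 1, state m (n + i) = (k, i) := by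
      intro i
      induction i with
      | zero => exact fun _ => hn
      | succ i ih =>
        intro hi
        rw [← add_assoc, state_succ, ih (by omega), nextState, if_pos (by simpa using hi)]
    refine ⟨n + (m k + 1) + 1, ?_⟩
    rw [state_succ, h _ le_rfl, nextState, if_neg (by simp)]

/-- The value of the maximal ideal of the ring at the position `p`. -/
noncomputable def stateValue (m : ℕ → ℕ) (p : ℕ × ℕ) : ℝ :=
  if p.2 < m p.1 then (1 / 2) ^ p.1 else (1 / 2) ^ (p.1 + 1)

theorem stateValue_pos (m : ℕ → ℕ) (p : ℕ × ℕ) : 0 < stateValue m p := by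
  rw [stateValue]
  split_ifs <;> positivity

/-- The sum of the values at the positions before `p`. -/
noncomputable def partialSum (m : ℕ → ℕ) (p : ℕ × ℕ) : ℝ :=
  ∑ j ∈ Finset.range p.1, ((m j : ℝ) + 1) * (1 / 2) ^ j + ((min p.2 (m p.1) : ℕ) : ℝ) * (1 / 2) ^ p.1 +
    if p.2 ≤ m p.1 then 0 else (1 / 2) ^ (p.1 + 1)

theorem sum_stateValue (m : ℕ → ℕ) (n : ℕ) :
    ∑ i ∈ Finset.range n, stateValue m (state m i) = partialSum m (state m n) := by
  induction n with
  | zero => simp [state, partialSum]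
  | succ n ih =>
    rw [Finset.sum_range_succ, ih, state_succ]
    have hle := state_snd_le m n
    generalize state m n = p at hle
    obtain ⟨k, i⟩ := p
    simp only at hle
    rcases lt_trichotomy i (m k) with hi | rfl | hi
    · have h1 : i + 1 ≤ m k := hi
      simp only [nextState, hi.le, if_true, partialSum, stateValue, hi, h1, min_eq_left]
      push_cast
      ring
    · simp [nextState, partialSum, stateValue]
    · obtain rfl : i = m k + 1 := by omega
      simp [nextState, partialSum, stateValue, Finset.sum_range_succ]
      ring

/-- Block $k$ contributes $2^{-k}$, whence the bound $2$. -/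
theorem tsum_stateValue_zero_lt_top :
    ∑' n, ENNReal.ofReal (stateValue (fun _ => 0) (state (fun _ => 0) n)) < ⊤ := by
  refine (tsum_ofReal_le_of_sum_le (fun n => (stateValue_pos _ _).le) (c := 2) fun n => ?_).trans_lt
    ENNReal.ofReal_lt_top
  rw [sum_stateValue, partialSum]
  have hgeom : ∀ k : ℕ, ∑ j ∈ Finset.range k, (((0 : ℕ) : ℝ) + 1) * (1 / 2) ^ j =
      2 - 2 * (1 / 2) ^ k := by
    intro k
    induction k with
    | zero => simp
    | succ k ih => rw [Finset.sum_range_succ, ih]; push_cast; ring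
  rw [hgeom]
  have h2 : (0 : ℝ) < (1 / 2) ^ (state (fun _ => 0) n).1 := by positivity
  simp only [Nat.min_zero, Nat.cast_zero, zero_mul, add_zero, pow_succ]
  split_ifs <;> linarith

/-- Block $k$ contributes $(2^k+1)2^{-k}\ge1$. -/
theorem tsum_stateValue_two_pow :
    ∑' n, ENNReal.ofReal (stateValue (2 ^ ·) (state (2 ^ ·) n)) = ⊤ := by
  refine ENNReal.eq_top_of_forall_nnreal_le fun r => ?_
  obtain ⟨k, hk⟩ := exists_nat_ge r
  obtain ⟨n, hn⟩ := exists_state_eq (2 ^ ·) k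
  refine le_trans ?_ (ENNReal.sum_le_tsum (Finset.range n))
  rw [← ENNReal.ofReal_sum_of_nonneg fun i _ => (stateValue_pos _ _).le, sum_stateValue, hn,
    ← ENNReal.ofReal_coe_nnreal]
  refine ENNReal.ofReal_le_ofReal (le_trans (b := (k : ℝ)) (by exact_mod_cast hk) ?_)
  simp only [partialSum, zero_le, if_true, min_eq_left, Nat.cast_zero, zero_mul, add_zero]
  refine le_trans (b := ∑ j ∈ Finset.range k, (1 : ℝ)) (by simp) (Finset.sum_le_sum fun j _ => ?_)
  have h1 : ((2 : ℝ) ^ j) * (1 / 2) ^ j = 1 := by rw [← mul_pow]; norm_num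
  have h2 : (0 : ℝ) < (1 / 2) ^ j := by positivity
  push_cast
  nlinarith

end States

/-! ### The quadratic sequence along the valuation of a tower -/

section Sequence

variable {k K : Type*} [Field k] [Field K] [Algebra k K]

/-- The parameter of least value at the position `p`. -/
def firstParameter (m : ℕ → ℕ) (x : ℕ → K) (p : ℕ × ℕ) : K :=
  if p.2 < m p.1 then x p.1 else x (p.1 + 1)

/-- The other parameter at the position `p`. -/
def secondParameter (m : ℕ → ℕ) (x y : ℕ → K) (p : ℕ × ℕ) : K :=
  if p.2 < m p.1 then y p.1 / x p.1 ^ p.2 else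
    if p.2 = m p.1 then x p.1 else x p.1 / x (p.1 + 1)

namespace IsParameterTower

variable {m : ℕ → ℕ} {x y : ℕ → K} (h : IsParameterTower k m x y)
include h

theorem y_div_pow (n : ℕ) : y n / x n ^ m n = x (n + 1) := by
  have h1 : y (n + 1) + 1 ≠ 0 := by
    intro h0
    exact h.x_ne_zero n (by rw [h.eq_x, h0, mul_zero])
  have h2 := h.x_ne_zero (n + 1)
  rw [div_eq_iff (pow_ne_zero _ (h.x_ne_zero n)), h.eq_y, h.eq_x n, mul_pow, ← pow_mul]
  ring

theorem coordRing_parameters {p : ℕ × ℕ} (hp : p.2 ≤ m p.1) :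
    coordRing k (firstParameter m x p) (secondParameter m x y p) =
      coordRing k (x p.1) (y p.1 / x p.1 ^ p.2) := by
  rw [firstParameter, secondParameter]
  split_ifs with h1 h2
  · rfl
  · rw [h2, h.y_div_pow, coordRing_comm]
  · omega

/-- A translation is needed only at the end of a block, where $x_n/x_{n+1}^2=y_{n+1}+1$ has residue
one. Elsewhere $c=0$; at $i=m_n$ the parameters change roles because $y_n/x_n^{m_n}=x_{n+1}$ has
smaller value than $x_n$. -/
theorem exists_coordRing_nextState {p : ℕ × ℕ} (hp : p.2 ≤ m p.1 + 1) :
    ∃ c : k, coordRing k (firstParameter m x (nextState m p))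
        (secondParameter m x y (nextState m p)) =
      coordRing k (firstParameter m x p)
        (secondParameter m x y p / firstParameter m x p - algebraMap k K c) := by
  obtain ⟨n, i⟩ := p
  simp only at hp
  have hx := h.x_ne_zero n
  have hx' := h.x_ne_zero (n + 1)
  rcases lt_trichotomy i (m n) with hi | rfl | hi
  · refine ⟨0, ?_⟩
    simp only [nextState, hi.le, if_true]
    rw [h.coordRing_parameters (by simpa using hi)]
    simp only [firstParameter, secondParameter, hi, if_true, map_zero, sub_zero]
    rw [div_div, ← pow_succ]
  · refine ⟨0, ?_⟩
    simp [nextState, firstParameter, secondParameter]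
  · obtain rfl : i = m n + 1 := by omega
    refine ⟨1, ?_⟩
    have h0 : ¬ m n + 1 ≤ m n := by omega
    have h1 : ¬ m n + 1 < m n := by omega
    have h2 : ¬ m n + 1 = m n := by omega
    simp only [nextState, h0, if_false]
    rw [h.coordRing_parameters (by simp)]
    simp only [firstParameter, secondParameter, h1, h2, if_false, pow_zero, div_one, map_one]
    congr 1
    rw [h.eq_x n]
    field_simp
    ring

variable {v : AddValuation K (WithTop ℝ)} (hv : ∀ z r, HasValue k x y z r → v z = r)
include hv

omit h in
theorem map_firstParameter (p : ℕ × ℕ) : v (firstParameter m x p) = (stateValue m p : ℝ) := by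
  rw [firstParameter, stateValue]
  split_ifs <;> exact map_x hv _

theorem stateValue_le_map_secondParameter {p : ℕ × ℕ} (hp : p.2 ≤ m p.1 + 1) :
    (stateValue m p : WithTop ℝ) ≤ v (secondParameter m x y p) := by
  obtain ⟨n, i⟩ := p
  simp only at hp
  have h2 : (0 : ℝ) < (1 / 2) ^ n := by positivity
  rw [secondParameter, stateValue]
  simp only
  split_ifs with h1 h3
  · have hpow : v (x n ^ i) = ((i * (1 / 2) ^ n : ℝ) : WithTop ℝ) := by
      rw [AddValuation.map_pow, map_x hv, ← nsmul_eq_mul]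
      norm_cast
    rw [map_div_eq (h.map_y hv n) hpow]
    have h4 : (i : ℝ) + 1 ≤ m n := by exact_mod_cast h1
    have : ((1 / 2) ^ n : ℝ) ≤ m n * (1 / 2) ^ n + (1 / 2) ^ (n + 1) - i * (1 / 2) ^ n := by
      rw [pow_succ]
      nlinarith
    exact_mod_cast this
  · rw [map_x hv]
    have : ((1 / 2) ^ (n + 1) : ℝ) ≤ (1 / 2) ^ n := by
      rw [pow_succ]
      linarith
    exact_mod_cast this
  · rw [map_div_eq (map_x hv n) (map_x hv (n + 1))]
    have : ((1 / 2) ^ (n + 1) : ℝ) ≤ (1 / 2) ^ n - (1 / 2) ^ (n + 1) := by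
      rw [pow_succ]
      linarith
    exact_mod_cast this

omit h in
theorem not_isDiscreteValuationRing : ¬ IsDiscreteValuationRing (valuationRing v) := by
  intro hV
  obtain ⟨ε, hε0, hε⟩ := exists_pos_le_of_isDiscreteValuationRing hV
  obtain ⟨n, hn⟩ := exists_pow_lt_of_lt_one hε0 (by norm_num : (1 / 2 : ℝ) < 1)
  have h2 : (0 : ℝ) < (1 / 2) ^ n := by positivity
  have := hε (x n) (by rw [map_x hv]; exact_mod_cast h2)
  rw [map_x hv] at this
  exact hn.not_ge (by exact_mod_cast this)

theorem rationalRank_eq_one : rationalRank v = 1 :=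
  rank_eq_one _ 1 ⟨x 0, by rw [map_x hv, pow_zero]⟩ one_ne_zero
    fun _ ⟨_, hz⟩ => h.exists_rat_of_map_eq hv hz

theorem exists_isQuadraticSequenceAlong :
    ∃ R : ℕ → LocalSubring K, IsQuadraticSequenceAlong v R ∧
      ∀ n, maximalIdealValue v (R n) = ENNReal.ofReal (stateValue m (state m n)) := by
  have hk : ∀ c : k, c ≠ 0 → v (algebraMap k K c) = 0 := fun c hc => map_algebraMap hv hc
  let u : ℕ → K := fun n => firstParameter m x (state m n)
  let w : ℕ → K := fun n => secondParameter m x y (state m n)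
  have hu : ∀ n, v (u n) = (stateValue m (state m n) : ℝ) := fun n => map_firstParameter hv _
  have hu0 : ∀ n, 0 < v (u n) := fun n => by
    rw [hu]
    exact_mod_cast stateValue_pos m _
  have huw : ∀ n, v (u n) ≤ v (w n) := fun n =>
    (hu n).trans_le (h.stateValue_le_map_secondParameter hv (state_snd_le m n))
  have hw0 : ∀ n, 0 < v (w n) := fun n => (hu0 n).trans_le (huw n)
  have hune : ∀ n, u n ≠ 0 := fun n hn => by
    have := hu n
    rw [hn] at this
    simp at this
  have hle : ∀ n, coordRing k (u n) (w n) ≤ (valuationRing v).toLocalSubring.toSubring :=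
    fun n => coordRing_le_valuationRing hk (hu0 n).le (hw0 n).le
  let R : ℕ → LocalSubring K := fun n =>
    LocalSubring.ofPrime (coordRing k (u n) (w n)) (center _ (valuationRing v) (hle n))
  -- If `m 0 = 0`, the initial pair is `x 1 = y 0` and `x 0`, so the parameters agree only up to
  -- order.
  have h00 : coordRing k (u 0) (w 0) = coordRing k (x 0) (y 0) := by
    exact (h.coordRing_parameters (p := state m 0) (by simp [state])).trans (by simp [state])
  have hle0 : coordRing k (x 0) (y 0) ≤ (valuationRing v).toLocalSubring.toSubring := h00 ▸ hle 0
  have hR0 : R 0 = LocalSubring.ofPrime (coordRing k (x 0) (y 0))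
      (center _ (valuationRing v) hle0) := ofPrime_center_congr h00 _ _
  have hrange : (evalAt k (x 0) (y 0)).range = coordRing k (x 0) (y 0) := by
    refine le_antisymm ?_ (coordRing_le (fun c => ⟨C (C c), evalAt_C_C _ _ _⟩)
      ⟨X, evalAt_X _ _⟩ ⟨C X, evalAt_C_X _ _⟩)
    rintro _ ⟨f, rfl⟩
    induction f using Polynomial.induction_on' with
    | add f g hf hg => rw [map_add]; exact add_mem hf hg
    | monomial a p =>
      rw [← C_mul_X_pow_eq_monomial, map_mul, map_pow, evalAt_X]
      refine mul_mem ?_ (pow_mem (left_mem_coordRing _ _) _)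
      induction p using Polynomial.induction_on' with
      | add f g hf hg => rw [C_add, map_add]; exact add_mem hf hg
      | monomial b c =>
        rw [← C_mul_X_pow_eq_monomial, C_mul, C_pow, map_mul, map_pow, evalAt_C_X, evalAt_C_C]
        exact mul_mem (algebraMap_mem_coordRing _ _ c) (pow_mem (right_mem_coordRing _ _) _)
  let e : k[X][X] ≃+* coordRing k (x 0) (y 0) :=
    (RingEquiv.ofBijective (evalAt k (x 0) (y 0)).rangeRestrict
      ⟨fun a b hab => h.injective 0 (congrArg Subtype.val hab),
        (evalAt k (x 0) (y 0)).rangeRestrict_surjective⟩).trans (RingEquiv.subringCongr hrange)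
  have he : ∀ f, ((e f : coordRing k (x 0) (y 0)) : K) = evalAt k (x 0) (y 0) f := fun _ => rfl
  have hreg := isRegularLocalRing_ofPrime e (center _ (valuationRing v) hle0)
    (mem_center_iff.2 (by
      rw [he, evalAt_X, map_x hv]
      norm_num))
    (mem_center_iff.2 (by
      rw [he, evalAt_C_X, h.map_y hv]
      have : (0 : ℝ) < m 0 * (1 / 2) ^ 0 + (1 / 2) ^ (0 + 1) := by positivity
      exact_mod_cast this))
  have hRV : ∀ n, R n ≤ (valuationRing v).toLocalSubring := fun n => ofPrime_center_le (hle n)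
  have hAR : ∀ n, coordRing k (u n) (w n) ≤ (R n).toSubring := fun n =>
    LocalSubring.le_ofPrime _ _
  refine ⟨R, ⟨hR0 ▸ hreg.1, hR0 ▸ hreg.2, ?_, hRV 0, ?_, fun n => ?_⟩, fun n =>
    maximalIdealValue_ofPrime hk (hu n) (hu0 n) (huw n) (hle n)⟩
  · refine IsFractionRing.of_field _ _ fun z => ?_
    obtain ⟨f, g, rfl⟩ := h.exists_div z
    have hmem : ∀ f, evalAt k (x 0) (y 0) f ∈ (R 0).toSubring := fun f =>
      hAR 0 (h00 ▸ hrange ▸ ⟨f, rfl⟩)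
    exact ⟨⟨_, hmem f⟩, ⟨_, hmem g⟩, rfl⟩
  · refine isZeroDimensionalOver_of_forall_exists (hRV 0) fun z hz => ?_
    obtain ⟨c, hc⟩ := h.exists_algebraMap_sub_pos hv hz
    exact ⟨_, hAR 0 (algebraMap_mem_coordRing _ _ c), hc⟩
  · obtain ⟨c, hc⟩ := h.exists_coordRing_nextState (state_snd_le m n)
    rw [← state_succ] at hc
    have hle' : coordRing k (u n) (w n / u n - algebraMap k K c) ≤
        (valuationRing v).toLocalSubring.toSubring := hc ▸ hle (n + 1)
    have := isQuadraticTransformAlong_ofPrime hk (hune n) (hu0 n) (hw0 n) c (hle n) hle'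
    rwa [← ofPrime_center_congr hc (hle (n + 1)) hle'] at this

end IsParameterTower

end Sequence

/-- Real valuations of rational rank one on `ℚ(x, y)` with prescribed values of the maximal ideals
in the sequence of local quadratic transforms. -/
theorem exists_isQuadraticSequenceAlong_valueSum_eq (m : ℕ → ℕ) :
    ∃ (K : Type) (_ : Field K) (v : AddValuation K (WithTop ℝ)) (R : ℕ → LocalSubring K),
      IsQuadraticSequenceAlong v R ∧ rationalRank v = 1 ∧
        ¬ IsDiscreteValuationRing (valuationRing v) ∧
        valueSum v R = ∑' n, ENNReal.ofReal (stateValue m (state m n)) := by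
  let K := FractionRing ℚ[X][X]
  have hev : evalAt ℚ (algebraMap ℚ[X][X] K X) (algebraMap ℚ[X][X] K (C X)) =
      algebraMap ℚ[X][X] K := by
    ext
    · simp [evalAt]
    · simp [evalAt]
    · simp [evalAt]
  obtain ⟨x, y, -, -, h⟩ := exists_isParameterTower (k := ℚ) m
    (x₀ := algebraMap ℚ[X][X] K X) (y₀ := algebraMap ℚ[X][X] K (C X))
    (by rw [hev]; exact IsFractionRing.injective _ _)
    (fun z => by
      obtain ⟨f, g, -, hz⟩ := IsFractionRing.div_surjective (A := ℚ[X][X]) z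
      exact ⟨f, g, by rw [hev, hz]⟩)
  obtain ⟨v, hv⟩ := h.exists_addValuation
  obtain ⟨R, hR, hval⟩ := h.exists_isQuadraticSequenceAlong hv
  exact ⟨K, inferInstance, v, R, hR, h.rationalRank_eq_one hv,
    IsParameterTower.not_isDiscreteValuationRing hv, tsum_congr hval⟩

end QuadraticTransforms

open QuadraticTransforms in
theorem proposition6p2 :
    (∀ (K : Type*) [Field K] (v : AddValuation K (WithTop ℝ)) (R : ℕ → LocalSubring K),
      IsQuadraticSequenceAlong v R →
        (IsDiscreteValuationRing (valuationRing v) →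
          valueSum v R = ⊤ ∧ (⋃ n, ((R n).toSubring : Set K)) = (valuationRing v : Set K)) ∧
        (valueSum v R = ⊤ → SwitchesStronglyInfinitelyOften R) ∧
        (2 ≤ rationalRank v → valueSum v R < ⊤) ∧
        (valueSum v R = ⊤ → rationalRank v = 1)) ∧
    (∃ (K : Type) (_ : Field K) (v : AddValuation K (WithTop ℝ)) (R : ℕ → LocalSubring K),
      IsQuadraticSequenceAlong v R ∧ rationalRank v = 1 ∧
        ¬ IsDiscreteValuationRing (valuationRing v) ∧ valueSum v R = ⊤) ∧
    (∃ (K : Type) (_ : Field K) (v : AddValuation K (WithTop ℝ)) (R : ℕ → LocalSubring K),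
      IsQuadraticSequenceAlong v R ∧ rationalRank v = 1 ∧
        ¬ IsDiscreteValuationRing (valuationRing v) ∧ valueSum v R < ⊤) := by
  refine ⟨fun K _ v R h => ⟨fun hV => ?_, switchesStronglyInfinitelyOften_of_valueSum_eq_top h,
    valueSum_lt_top_of_two_le_rationalRank h, rationalRank_eq_one_of_valueSum_eq_top h⟩, ?_, ?_⟩
  · have hs := valueSum_eq_top_of_isDiscreteValuationRing h hV
    exact ⟨hs, iUnion_eq_of_valueSum_eq_top h hs⟩
  · obtain ⟨K, hK, v, R, hR, hrank, hV, hs⟩ := exists_isQuadraticSequenceAlong_valueSum_eq (2 ^ ·)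
    exact ⟨K, hK, v, R, hR, hrank, hV, hs.trans tsum_stateValue_two_pow⟩
  · obtain ⟨K, hK, v, R, hR, hrank, hV, hs⟩ := exists_isQuadraticSequenceAlong_valueSum_eq fun _ => 0
    exact ⟨K, hK, v, R, hR, hrank, hV, hs.trans_lt tsum_stateValue_zero_lt_top⟩
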